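/- **Setting.** Fix $\theta,L,B>0$, $k\in(0,1)$ and an integer $D\ge 0$. For $m>0$ let $\mathrm{NB}(\theta,m)$ be the law on $\{0,1,2,\dots\}$ with mass function $f(y;\theta,m)=\frac{\Gamma(\theta+y)}{\Gamma(\theta)\,y!}\big(\frac{m}{\theta+m}\big)^y\big(\frac{\theta}{\theta+m}\big)^\theta$. For $n,p\ge 1$ let $(X_1,Y_1),\dots,(X_n,Y_n)$ be independent, with $X_i$ a random vector in $\mathbb R^p$ and, conditionally on $X_i$, $Y_i\sim \mathrm{NB}(\theta,e^{X_i^T\beta^*})$, where $\beta^*\in\mathbb R^p$ is the true coefficient vector, $H=\{j:\beta^*_j\ne0\}$ and $d^*=|H|\le D$. (The rows $X_i$ need not be identically distributed; an i.i.d. design and a deterministic design are both included.) Assume: * almost surely $|X_{ij}|\le L$ for all $i,j$; $\|\beta^*\|_\infty\le B$; and almost surely $|X_i^T\beta^*|\le LB$ for all $i$ (for instance $\|\beta^*\|_1\le B$); * Stabil condition $S(3.5,\varepsilon_n,k)$ with $\varepsilon_n\ge 0$: with $\Sigma=\frac1n\sum_{i=1}^n\mathrm E(X_iX_i^T)$ (which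 is $\mathrm E(XX^T)$ for i.i.d. rows), $b^T\Sigma b\ge k\sum_{j\in H}b_j^2-\varepsilon_n$ for every $b\in\mathbb R^p$ with $\sum_{j\notin H}|b_j|\le 3.5\sum_{j\in H}|b_j|+\varepsilon_n$; * $A>1$, $M=16B+2\varepsilon_n$, and $C$ is a constant with $\mathrm E Z^q\le q!\,C^q$ for all integers $q\ge1$ and all $Z\sim \mathrm{NB}(\theta,e^t)$, $|t|\le LB$; * $\lambda_1\ge\max\Big\{32A^2LC\,\frac{\log 2p}{n},\ 16\sqrt2\,ALC\sqrt{\frac{\log 2p}{n}},\ \frac{20\theta AML}{M+\varepsilon_n}\sqrt{\frac{2\log 2p}{n}}\Big\}$ and $\lambda_2=\frac{\lambda_1}{8B}$. The elastic-net estimate $\hat\beta$ minimizes over $\beta\in\mathbb R^p$ $$-\frac1n\sum_{i=1}^n\big[Y_iX_i^T\beta-(\theta+Y_i)\log(\theta+e^{X_i^T\beta})\big]+\lambda_1\|\beta\|_1+\lambda_2\|\beta\|_2^2 .$$ Put $K=\max_{i,j}|X_{ij}|$, $\rho_{kl}=\frac1n\sum_{i}X_{ik}X_{il}$ for coordinates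 $k,l\in\{1,\dots,p\}$, and $$\mu=\frac{e^{LB}(\theta+e^{LB})}{\theta},\qquad \sigma^2=\Big(2+\frac6\theta\Big)\mu^2+\mu .$$ Let $\mathcal S$ be the event that the predictors are standardized: $\frac1n\sum_iX_{ij}^2=1$ and $\frac1n\sum_iX_{ij}=0$ for $j=1,\dots,p$. **Theorem (grouping effect oracle inequality).** There is a constant $C_0\ge0$ that depends only on $\theta,L,B,k,D$ (the $O(1)$ below) such that the following hold. (i) Under the above assumptions, for every $E>0$, with probability at least $1-2(2p)^{1-A^2}-(2p)^{-A^2}-\frac{\sigma^2}{nE^2}$ the following is true: if $\mathcal S$ occurs, then for all $k,l\in\{1,\dots,p\}$ $$|\hat\beta_k-\hat\beta_l|^2\le\tfrac12(1-\rho_{kl})\Big[Ke^{2LM}C_0+\frac1{\lambda_2^2}(E+\mu)\Big].$$ (In particular, if the predictors are standardized almost surely, the inequality itself holds with at least this probability.) (ii) Consider a sequence of such models, with the same $\theta,L,B,k,D,A,C$, with $n\to\infty$, $p=p_n\to\infty$, $\lambda_2^2=O(\frac{\log p}{n})$ and $\frac{\log p}n\to0$, and with coordinates $k=k_n$, $l=l_n$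 such that $\rho_{kl}=1-o_p(\lambda_2^2)$ on $\mathcal S$, that is, $P\big(\mathcal S\cap\{|R_n|>\delta\}\big)\to0$ for every $\delta>0$, where $R_n=(1-\rho_{kl})/\lambda_2^2$. Then for every $E>0$, with probability at least $1-2(2p)^{1-A^2}-(2p)^{-A^2}-\frac{\sigma^2}{nE^2}$, if $\mathcal S$ occurs then $$|\hat\beta_k-\hat\beta_l|\le\sqrt{\tfrac12R_n\big[\lambda_2^2e^{2LM}C_0+(E+\mu)\big]},$$ and $|\hat\beta_k-\hat\beta_l|\to0$ in probability on $\mathcal S$, i.e. $P\big(\mathcal S\cap\{|\hat\beta_k-\hat\beta_l|>\delta\}\big)\to0$ for every $\delta>0$. -/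

import Mathlib

open MeasureTheory ProbabilityTheory Filter Topology Asymptotics
open scoped BigOperators Matrix

universe u

noncomputable section

/-- Probability mass at `y` of the negative binomial law with dispersion `θ` and mean `m`. -/
def nbPMF (θ m : ℝ) (y : ℕ) : ℝ :=
  Real.Gamma (θ + y) / (Real.Gamma θ * (y.factorial : ℝ)) *
    (m / (θ + m)) ^ y * (θ / (θ + m)) ^ θ

/-- `C` bounds the moments of all negative binomial laws whose linear predictor lies in
`[-R, R]`: one has `E Z ^ q ≤ q! C ^ q` for every `q ≥ 1` (the moments being finite). -/
def IsMomentConstant (θ R C : ℝ) : Prop :=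
  ∀ t : ℝ, |t| ≤ R → ∀ q : ℕ, 1 ≤ q →
    Summable (fun y : ℕ => (y : ℝ) ^ q * nbPMF θ (Real.exp t) y) ∧
    ∑' y : ℕ, (y : ℝ) ^ q * nbPMF θ (Real.exp t) y ≤ (q.factorial : ℝ) * C ^ q

/-- Average negative log-likelihood of negative binomial regression with design rows `x i` and
counts `y i` (up to a term that does not depend on the coefficient vector `b`). -/
def nbLoss {n p : ℕ} (θ : ℝ) (x : Fin n → Fin p → ℝ) (y : Fin n → ℕ) (b : Fin p → ℝ) : ℝ :=
  -(1 / (n : ℝ)) * ∑ i, ((y i : ℝ) * (x i ⬝ᵥ b)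
    - (θ + (y i : ℝ)) * Real.log (θ + Real.exp (x i ⬝ᵥ b)))

/-- The elastic-net objective. -/
def enObjective {n p : ℕ} (θ lam1 lam2 : ℝ) (x : Fin n → Fin p → ℝ) (y : Fin n → ℕ)
    (b : Fin p → ℝ) : ℝ :=
  nbLoss θ x y b + lam1 * ∑ j, |b j| + lam2 * ∑ j, b j ^ 2

/-- `b` is the elastic-net estimate: it minimizes the objective over all of `ℝ^p`. -/
def IsElasticNet {n p : ℕ} (θ lam1 lam2 : ℝ) (x : Fin n → Fin p → ℝ) (y : Fin n → ℕ)
    (b : Fin p → ℝ) : Prop :=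
  IsMinOn (enObjective θ lam1 lam2 x y) Set.univ b

/-- The support `H` of a coefficient vector. -/
def coefSupport {p : ℕ} (b : Fin p → ℝ) : Finset (Fin p) :=
  Finset.univ.filter (fun j => b j ≠ 0)

/-- The fluctuated cone `V(c, ε) = {b : ‖b_{Hᶜ}‖₁ ≤ c ‖b_H‖₁ + ε}`. -/
def fluctCone {p : ℕ} (H : Finset (Fin p)) (c ε : ℝ) : Set (Fin p → ℝ) :=
  {b | ∑ j ∈ Hᶜ, |b j| ≤ c * ∑ j ∈ H, |b j| + ε}

/-- The Stabil condition `S(c, ε, k)` for the matrix `S` and the index set `H`. -/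
def StabilCondition {p : ℕ} (H : Finset (Fin p)) (S : Matrix (Fin p) (Fin p) ℝ)
    (c ε k : ℝ) : Prop :=
  0 < k ∧ k < 1 ∧
    ∀ b ∈ fluctCone H c ε, k * ∑ j ∈ H, b j ^ 2 - ε ≤ b ⬝ᵥ (S *ᵥ b)

/-- The population matrix `(1/n) ∑ᵢ E (Xᵢ Xᵢᵀ)`. For identically distributed rows it is
`E (X Xᵀ)`, for a deterministic design it is the Gram matrix. -/
def popGram {Ω : Type u} [MeasurableSpace Ω] (P : Measure Ω) {n p : ℕ}
    (X : Fin n → Ω → Fin p → ℝ) : Matrix (Fin p) (Fin p) ℝ :=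
  Matrix.of fun j l => (1 / (n : ℝ)) * ∑ i, ∫ ω, X i ω j * X i ω l ∂P

/-- The constant `M = 16 B + 2 ε`. -/
def radiusM (B ε : ℝ) : ℝ := 16 * B + 2 * ε

/-- The lower bound `max (G₁, G₂, G₃)` for the tuning parameter `λ₁`. -/
def tuningBound (θ L B A C ε : ℝ) (n p : ℕ) : ℝ :=
  max (32 * A ^ 2 * L * C * (Real.log (2 * (p : ℝ)) / (n : ℝ)))
    (max (16 * √2 * A * L * C * √(Real.log (2 * (p : ℝ)) / (n : ℝ)))
      (20 * θ * A * radiusM B ε * L / (radiusM B ε + ε) *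
        √(2 * Real.log (2 * (p : ℝ)) / (n : ℝ))))

/-- The negative binomial regression model with independent observations `(Xᵢ, Yᵢ)`, together
with the assumptions on the design, the true coefficient vector `βs` and the tuning
parameters. -/
structure OracleHypotheses {Ω : Type u} [MeasurableSpace Ω] (P : Measure Ω) {n p : ℕ}
    (X : Fin n → Ω → Fin p → ℝ) (Y : Fin n → Ω → ℕ) (βs : Fin p → ℝ)
    (θ L B k A C ε lam1 lam2 : ℝ) : Prop where
  isProb : IsProbabilityMeasure P
  n_pos : 0 < n
  p_pos : 0 < p
  measurable_X : ∀ i, Measurable (X i)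
  measurable_Y : ∀ i, Measurable (Y i)
  indep : iIndepFun (fun i ω => (X i ω, Y i ω)) P
  /-- Given `Xᵢ`, the response `Yᵢ` is negative binomial with mean `exp (Xᵢᵀ βs)`. -/
  condLaw : ∀ i (y : ℕ),
    P⟦Y i ⁻¹' {y} | MeasurableSpace.comap (X i) inferInstance⟧
      =ᵐ[P] fun ω => nbPMF θ (Real.exp (X i ω ⬝ᵥ βs)) y
  bounded_X : ∀ i, ∀ᵐ ω ∂P, ∀ j, |X i ω j| ≤ L
  bounded_beta : ∀ j, |βs j| ≤ B
  bounded_predictor : ∀ i, ∀ᵐ ω ∂P, |X i ω ⬝ᵥ βs| ≤ L * B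
  eps_nonneg : 0 ≤ ε
  stabil : StabilCondition (coefSupport βs) (popGram P X) 3.5 ε k
  one_lt_A : 1 < A
  momentConstant : IsMomentConstant θ (L * B) C
  lam1_ge : tuningBound θ L B A C ε n p ≤ lam1
  lam2_eq : lam2 = lam1 / (8 * B)

/-- Every predictor has empirical second moment `1` and empirical mean `0`. -/
def Standardized {n p : ℕ} (x : Fin n → Fin p → ℝ) : Prop :=
  ∀ j, (1 / (n : ℝ)) * ∑ i, x i j ^ 2 = 1 ∧ (1 / (n : ℝ)) * ∑ i, x i j = 0

/-- The empirical correlation coefficient `ρ_{kl}` of standardized predictors. -/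
def empCorr {n p : ℕ} (x : Fin n → Fin p → ℝ) (k l : Fin p) : ℝ :=
  (1 / (n : ℝ)) * ∑ i, x i k * x i l

/-- `K = max |x_{ij}|`. -/
def maxEntry {n p : ℕ} (x : Fin n → Fin p → ℝ) : ℝ := ⨆ i, ⨆ j, |x i j|

/-- The bound `μ` for the variances of the responses. -/
def varBound (θ L B : ℝ) : ℝ :=
  Real.exp (L * B) * (θ + Real.exp (L * B)) / θ

/-- The bound `σ²` for the variances of the squared centred responses. -/
def sqVarBound (θ L B : ℝ) : ℝ :=
  (2 + 6 / θ) * varBound θ L B ^ 2 + varBound θ L B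

/-- The failure probability `2 (2p)^{1-A²} + (2p)^{-A²} + σ² / (n E²)`. -/
def failureProb (θ L B A E : ℝ) (n p : ℕ) : ℝ :=
  2 * (2 * (p : ℝ)) ^ (1 - A ^ 2) + (2 * (p : ℝ)) ^ (-A ^ 2)
    + sqVarBound θ L B / ((n : ℝ) * E ^ 2)

end

/-! Moving the `k`-th and `l`-th coefficients of the minimizer towards their average does not
increase the ℓ¹ norm, so only the smooth part of the objective enters the first-order condition. It
bounds `2 λ₂ |b k - b l|` by the averaged product of the scores with `x i k - x i l`; Cauchy–Schwarz
and standardization then give `IsElasticNet.grouping`, with factor `(1 - ρ) / (2 λ₂²)` times the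
mean squared score at the estimate.

It remains to bound that mean by `E + μ` plus a multiple of `λ₂²`. On the event that the gradient at
the true coefficients is at most `λ₁ / 2`, the basic inequality and local strong convexity yield a
prediction error of order `λ₁`, hence of order `λ₂` (`IsElasticNet.slow_rate`). One order in `λ₂` is
missing, but the score is the residual shrunk by a factor at most `s < 1`. This leaves the slack `(1
- s) μ`, and by the arithmetic-geometric mean inequality a term `Q λ₂` is at most that slack plus a
constant times `λ₂²` (`IsElasticNet.mean_score_sq_le`).

The probabilistic part bounds two events. The gradient is handled by Chernoff's method, using a
sub-exponential bound derived from the moment constant (`nb_mgf_le`). The mean squared residual is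
handled by Chebyshev's inequality, using the exact fourth moment obtained from Stein's identity
(`hasSum_nb_sq_variance`). -/

/-! ### Score and curvature of a single observation. -/

/-- The contribution of one observation to the negative log-likelihood. -/
noncomputable def nbNegLog (θ y η : ℝ) : ℝ :=
  -(y * η - (θ + y) * Real.log (θ + Real.exp η))

/-- The score of one observation, i.e. minus the derivative of `nbNegLog`. -/
noncomputable def nbScore (θ y η : ℝ) : ℝ :=
  θ * (y - Real.exp η) / (θ + Real.exp η)

theorem nbLoss_eq_sum {n p : ℕ} (θ : ℝ) (x : Fin n → Fin p → ℝ) (y : Fin n → ℕ)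
    (b : Fin p → ℝ) :
    nbLoss θ x y b = (1 / (n : ℝ)) * ∑ i, nbNegLog θ (y i) (x i ⬝ᵥ b) := by
  simp only [nbLoss, nbNegLog, Finset.sum_neg_distrib]
  ring

theorem hasDerivAt_nbNegLog {θ : ℝ} (hθ : 0 < θ) (y η : ℝ) :
    HasDerivAt (nbNegLog θ y) (-(nbScore θ y η)) η := by
  have hpos : θ + Real.exp η ≠ 0 := (add_pos hθ (Real.exp_pos η)).ne'
  have h := (((hasDerivAt_id η).const_mul y).sub
    ((((Real.hasDerivAt_exp η).const_add θ).log hpos).const_mul (θ + y))).neg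
  refine h.congr_deriv ?_
  simp only [nbScore]
  field_simp
  ring

/-- The curvature constant of the negative log-likelihood on `[-R, R]`. -/
noncomputable def nbCurv (θ R : ℝ) : ℝ :=
  θ ^ 2 * Real.exp (-R) / (θ + Real.exp R) ^ 2

theorem nbCurv_pos {θ : ℝ} (hθ : 0 < θ) (R : ℝ) : 0 < nbCurv θ R := by
  unfold nbCurv; positivity

/-- The difference of scores is `θ (θ + y) (e^b - e^a) / ((θ + e^a) (θ + e^b))`. Since it increases
with `y`, replacing `θ + y` by `θ` gives a curvature bound uniform over the unbounded counts. -/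
theorem nbScore_sub_ge {θ y a b R : ℝ} (hθ : 0 < θ) (hy : 0 ≤ y) (ha : -R ≤ a) (hab : a ≤ b)
    (hb : b ≤ R) : nbCurv θ R * (b - a) ≤ nbScore θ y a - nbScore θ y b := by
  have hea := Real.exp_pos a
  have heb := Real.exp_pos b
  have h1 : nbScore θ y a - nbScore θ y b
      = θ * (θ + y) * (Real.exp b - Real.exp a)
        / ((θ + Real.exp a) * (θ + Real.exp b)) := by
    simp only [nbScore]
    field_simp
    ring
  have h2 : Real.exp (-R) * (b - a) ≤ Real.exp b - Real.exp a := by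
    have h3 : Real.exp b = Real.exp a * Real.exp (b - a) := by rw [← Real.exp_add]; ring_nf
    have h4 := Real.add_one_le_exp (b - a)
    have h5 : Real.exp (-R) ≤ Real.exp a := Real.exp_le_exp.mpr ha
    have h6 : Real.exp (-R) * (b - a) ≤ Real.exp a * (b - a) :=
      mul_le_mul_of_nonneg_right h5 (by linarith)
    rw [h3]
    nlinarith
  rw [h1, nbCurv, div_mul_eq_mul_div]
  have h7 : Real.exp a ≤ Real.exp R := Real.exp_le_exp.mpr (hab.trans hb)
  have h8 : Real.exp b ≤ Real.exp R := Real.exp_le_exp.mpr hb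
  have hnum : θ ^ 2 * Real.exp (-R) * (b - a) ≤ θ * (θ + y) * (Real.exp b - Real.exp a) := by
    calc θ ^ 2 * Real.exp (-R) * (b - a) = θ * θ * (Real.exp (-R) * (b - a)) := by ring
      _ ≤ θ * (θ + y) * (Real.exp b - Real.exp a) := by
        have : 0 ≤ Real.exp (-R) * (b - a) :=
          mul_nonneg (Real.exp_pos _).le (by linarith)
        gcongr
        linarith
  have hnn : 0 ≤ θ * (θ + y) * (Real.exp b - Real.exp a) :=
    mul_nonneg (by positivity) (by linarith [Real.exp_le_exp.mpr hab])
  refine div_le_div₀ hnn hnum (by positivity) ?_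
  rw [sq]
  gcongr

/-- A function whose derivative grows at rate at least `c` lies above the quadratic with
curvature `c` touching it. -/
theorem quadratic_le_of_deriv_growth {f f' : ℝ → ℝ} {c R a b : ℝ}
    (hf : ∀ t, HasDerivAt f (f' t) t)
    (hmono : ∀ s t, -R ≤ s → s ≤ t → t ≤ R → c * (t - s) ≤ f' t - f' s)
    (ha : |a| ≤ R) (hb : |b| ≤ R) :
    f a + f' a * (b - a) + c / 2 * (b - a) ^ 2 ≤ f b := by
  -- After subtracting the parabola, the slope is at least `f' a` to the right of `a` and at most
  -- `f' a` to the left, so the mean value theorem suffices on either side.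
  have hg : ∀ t, HasDerivAt (fun t => f t - c / 2 * (t - a) ^ 2) (f' t - c * (t - a)) t := by
    intro t
    have h := (hf t).sub ((((hasDerivAt_id t).sub_const a).pow 2).const_mul (c / 2))
    refine h.congr_deriv ?_
    simp
    ring
  have hcont : Continuous (fun t => f t - c / 2 * (t - a) ^ 2) :=
    continuous_iff_continuousAt.mpr fun t => (hg t).continuousAt
  rw [abs_le] at ha hb
  rcases lt_trichotomy a b with hab | hab | hab
  · obtain ⟨ξ, ⟨h1, h2⟩, h3⟩ := exists_hasDerivAt_eq_slope _ _ hab hcont.continuousOn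
      (fun t _ => hg t)
    rw [eq_div_iff (by linarith)] at h3
    have h4 := hmono a ξ ha.1 h1.le (by linarith)
    have h5 : 0 ≤ (f' ξ - c * (ξ - a) - f' a) * (b - a) :=
      mul_nonneg (by linarith) (by linarith)
    nlinarith
  · subst hab; simp
  · obtain ⟨ξ, ⟨h1, h2⟩, h3⟩ := exists_hasDerivAt_eq_slope _ _ hab hcont.continuousOn
      (fun t _ => hg t)
    rw [eq_div_iff (by linarith)] at h3
    have h4 := hmono ξ a (by linarith) h2.le ha.2
    have h5 : 0 ≤ (f' a - (f' ξ - c * (ξ - a))) * (a - b) :=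
      mul_nonneg (by linarith) (by linarith)
    nlinarith

theorem nbNegLog_quadratic_lower {θ y a b R : ℝ} (hθ : 0 < θ) (hy : 0 ≤ y) (ha : |a| ≤ R)
    (hb : |b| ≤ R) :
    nbNegLog θ y a - nbScore θ y a * (b - a) + nbCurv θ R / 2 * (b - a) ^ 2
      ≤ nbNegLog θ y b := by
  have h := quadratic_le_of_deriv_growth (f := nbNegLog θ y) (f' := fun t => -nbScore θ y t)
    (c := nbCurv θ R) (hasDerivAt_nbNegLog hθ y)
    (fun s t hs hst ht => by linarith [nbScore_sub_ge hθ hy hs hst ht]) ha hb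
  linarith

theorem abs_exp_sub_exp_le {a b R : ℝ} (ha : a ≤ R) (hb : b ≤ R) :
    |Real.exp a - Real.exp b| ≤ Real.exp R * |a - b| := by
  have key : ∀ s t : ℝ, s ≤ t → t ≤ R → Real.exp t - Real.exp s ≤ Real.exp R * (t - s) := by
    intro s t hst ht
    have h1 := Real.add_one_le_exp (s - t)
    have h2 : Real.exp s = Real.exp t * Real.exp (s - t) := by rw [← Real.exp_add]; ring_nf
    have h3 := Real.exp_le_exp.mpr ht
    have h4 := Real.exp_pos t
    have h5 : Real.exp t * (t - s) ≤ Real.exp R * (t - s) :=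
      mul_le_mul_of_nonneg_right h3 (by linarith)
    rw [h2]
    nlinarith
  rcases le_total a b with h | h
  · rw [abs_sub_comm, abs_sub_comm a b, abs_of_nonneg (by linarith : 0 ≤ b - a),
      abs_of_nonneg (by linarith [Real.exp_le_exp.mpr h])]
    exact key a b h hb
  · rw [abs_of_nonneg (by linarith : 0 ≤ a - b),
      abs_of_nonneg (by linarith [Real.exp_le_exp.mpr h])]
    exact key b a h ha

/-- The factor `θ / (θ + e^{-R}) < 1` by which the score is smaller than the residual. -/
noncomputable def nbShrink (θ R : ℝ) : ℝ := θ / (θ + Real.exp (-R))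

theorem nbShrink_pos {θ : ℝ} (hθ : 0 < θ) (R : ℝ) : 0 < nbShrink θ R := by
  unfold nbShrink; positivity

theorem nbShrink_lt_one {θ : ℝ} (hθ : 0 < θ) (R : ℝ) : nbShrink θ R < 1 := by
  unfold nbShrink
  rw [div_lt_one (by positivity)]
  linarith [Real.exp_pos (-R)]

/-- The score is the residual times `θ / (θ + e^b) ≤ s`. Of the two factors `s` in the square, one
pays for the cross term created by moving from `b` to `a`; the other stays on the squared residual
and provides the slack used later. -/
theorem nbScore_sq_le {θ y a b R : ℝ} (hθ : 0 < θ) (ha : |a| ≤ R) (hb : |b| ≤ R) :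
    nbScore θ y b ^ 2 ≤ nbShrink θ R * (y - Real.exp a) ^ 2
      + Real.exp R ^ 2 / (1 - nbShrink θ R) * (b - a) ^ 2 := by
  set s := nbShrink θ R with hs
  have hs0 : 0 < s := nbShrink_pos hθ R
  have hs1 : s < 1 := nbShrink_lt_one hθ R
  rw [abs_le] at ha hb
  have hr0 : 0 < θ / (θ + Real.exp b) := by positivity
  have hr : θ / (θ + Real.exp b) ≤ s := by
    rw [hs, nbShrink]
    gcongr
    exact hb.1
  have hE : (Real.exp a - Real.exp b) ^ 2 ≤ Real.exp R ^ 2 * (b - a) ^ 2 := by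
    rw [← mul_pow, ← sq_abs, ← sq_abs (Real.exp R * (b - a)), abs_mul,
      abs_of_pos (Real.exp_pos R), abs_sub_comm b a]
    exact pow_le_pow_left₀ (abs_nonneg _) (abs_exp_sub_exp_le ha.2 hb.2) 2
  have h1 : nbScore θ y b ^ 2 ≤ s ^ 2 * (y - Real.exp b) ^ 2 := by
    rw [nbScore, mul_div_right_comm, mul_pow]
    gcongr
  have h2 : s ^ 2 * (y - Real.exp b) ^ 2
      ≤ s * (y - Real.exp a) ^ 2 + (Real.exp a - Real.exp b) ^ 2 / (1 - s) := by
    set u := y - Real.exp a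
    set v := Real.exp a - Real.exp b
    have huv : y - Real.exp b = u + v := by simp only [u, v]; ring
    have h1s : 0 < 1 - s := by linarith
    set q := v ^ 2 / (1 - s) with hq
    have hq' : q * (1 - s) = v ^ 2 := by rw [hq]; field_simp
    have h4 : s * (u + v) ^ 2 ≤ u ^ 2 + s * q := by
      -- The difference of the two sides of `h4` is exactly this square over `1 - s`.
      have h5 : 0 ≤ ((1 - s) * u - s * v) ^ 2 / (1 - s) := by positivity
      have h6 : ((1 - s) * u - s * v) ^ 2 / (1 - s)
          = (1 - s) * u ^ 2 - 2 * s * u * v + s ^ 2 * q := by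
        rw [hq]; field_simp; ring
      nlinarith
    rw [huv]
    nlinarith
  calc nbScore θ y b ^ 2 ≤ _ := h1.trans h2
    _ ≤ s * (y - Real.exp a) ^ 2 + (Real.exp R ^ 2 * (b - a) ^ 2) / (1 - s) := by
      have : 0 < 1 - s := by linarith
      gcongr
    _ = _ := by ring

/-! ### Standardized designs. -/

theorem sum_sq_sub_eq_of_standardized {n p : ℕ} {x : Fin n → Fin p → ℝ} (hx : Standardized x)
    (k l : Fin p) :
    (1 / (n : ℝ)) * ∑ i, (x i k - x i l) ^ 2 = 2 * (1 - empCorr x k l) := by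
  have h1 := (hx k).1
  have h2 := (hx l).1
  have h3 : ∑ i, (x i k - x i l) ^ 2
      = ∑ i, x i k ^ 2 + ∑ i, x i l ^ 2 - 2 * ∑ i, x i k * x i l := by
    rw [Finset.mul_sum, ← Finset.sum_add_distrib, ← Finset.sum_sub_distrib]
    exact Finset.sum_congr rfl fun i _ => by ring
  rw [h3, empCorr]
  linear_combination h1 + h2

theorem one_sub_empCorr_nonneg {n p : ℕ} {x : Fin n → Fin p → ℝ} (hx : Standardized x)
    (k l : Fin p) : 0 ≤ 1 - empCorr x k l := by
  have h := sum_sq_sub_eq_of_standardized hx k l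
  have : 0 ≤ (1 / (n : ℝ)) * ∑ i, (x i k - x i l) ^ 2 := by positivity
  linarith

/-- A column whose mean square is one cannot have all entries below one in absolute value. This
allows the factor `K` to be inserted into the final bound for free. -/
theorem one_le_maxEntry_of_standardized {n p : ℕ} {x : Fin n → Fin p → ℝ} (hn : 0 < n)
    (hx : Standardized x) (j : Fin p) : 1 ≤ maxEntry x := by
  have hn' : (0 : ℝ) < n := by exact_mod_cast hn
  have hle : ∀ i, |x i j| ≤ maxEntry x := fun i =>
    (le_ciSup (f := fun j => |x i j|) (Set.finite_range _).bddAbove j).trans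
      (le_ciSup (f := fun i => ⨆ j, |x i j|) (Set.finite_range _).bddAbove i)
  have h0 : 0 ≤ maxEntry x := (abs_nonneg _).trans (hle ⟨0, hn⟩)
  have hsum : ∑ i, x i j ^ 2 ≤ n * maxEntry x ^ 2 := by
    calc ∑ i, x i j ^ 2 ≤ ∑ _i : Fin n, maxEntry x ^ 2 :=
          Finset.sum_le_sum fun i _ => by
            rw [← sq_abs]; exact pow_le_pow_left₀ (abs_nonneg _) (hle i) 2
      _ = n * maxEntry x ^ 2 := by simp
  have h1 := (hx j).1
  have h2 : ∑ i, x i j ^ 2 = n := by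
    field_simp at h1
    exact h1
  rw [h2] at hsum
  have h3 : 1 ≤ maxEntry x ^ 2 := by nlinarith
  nlinarith

/-! ### Optimality in the averaging direction and the grouping effect. -/

/-- The averaging direction does not increase the `ℓ¹` norm. -/
theorem sum_abs_add_average_le {p : ℕ} (b : Fin p → ℝ) (k l : Fin p) {t : ℝ} (h0 : 0 ≤ t)
    (h1 : t ≤ 1) :
    ∑ j, |b j + t * (((b k - b l) / 2) * ((Pi.single l 1 : Fin p → ℝ) j
      - (Pi.single k 1 : Fin p → ℝ) j))| ≤ ∑ j, |b j| := by
  have key : ∀ j, |b j + t * (((b k - b l) / 2) * ((Pi.single l 1 : Fin p → ℝ) j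
      - (Pi.single k 1 : Fin p → ℝ) j))| ≤ |b j| + t / 2 * (|b l| - |b k|)
        * ((Pi.single k 1 : Fin p → ℝ) j - (Pi.single l 1 : Fin p → ℝ) j) := by
    -- Each of the two coefficients becomes a convex combination with weight `t / 2` on the other;
    -- the resulting changes in the absolute-value bounds are opposite and cancel in the sum.
    have aux : ∀ u v : ℝ, |u + t * ((v - u) / 2)| ≤ |u| + t / 2 * (|v| - |u|) := by
      intro u v
      calc |u + t * ((v - u) / 2)| = |(1 - t / 2) * u + t / 2 * v| := by ring_nf
        _ ≤ |(1 - t / 2) * u| + |t / 2 * v| := abs_add_le _ _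
        _ = (1 - t / 2) * |u| + t / 2 * |v| := by
          rw [abs_mul, abs_mul, abs_of_nonneg (by linarith : 0 ≤ 1 - t / 2),
            abs_of_nonneg (by linarith : 0 ≤ t / 2)]
        _ = _ := by ring
    intro j
    by_cases hk : j = k <;> by_cases hl : j = l
    · subst hk; subst hl; simp
    · subst hk
      have := aux (b j) (b l)
      simp only [Pi.single_eq_same, Pi.single_eq_of_ne hl]
      convert this using 2 <;> ring
    · subst hl
      have := aux (b j) (b k)
      simp only [Pi.single_eq_same, Pi.single_eq_of_ne hk]
      convert this using 2 <;> ring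
    · simp [Pi.single_eq_of_ne hk, Pi.single_eq_of_ne hl]
  calc _ ≤ ∑ j, (|b j| + t / 2 * (|b l| - |b k|)
        * ((Pi.single k 1 : Fin p → ℝ) j - (Pi.single l 1 : Fin p → ℝ) j)) :=
        Finset.sum_le_sum fun j _ => key j
    _ = ∑ j, |b j| := by
      rw [Finset.sum_add_distrib, ← Finset.mul_sum, Finset.sum_sub_distrib]
      simp

/-- A one-sided version is needed because the ℓ¹ norm is controlled only for steps `t` in `[0, 1]`.
-/
theorem hasDerivAt_nonneg_of_min_right {f : ℝ → ℝ} {f' : ℝ} (hf : HasDerivAt f f' 0)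
    (hmin : ∀ t, 0 ≤ t → t ≤ 1 → f 0 ≤ f t) : 0 ≤ f' := by
  have h := hf.hasDerivWithinAt (s := Set.Ioi 0)
  rw [hasDerivWithinAt_iff_tendsto_slope' (by simp)] at h
  refine ge_of_tendsto h ?_
  filter_upwards [Ioc_mem_nhdsGT (show (0 : ℝ) < 1 by norm_num)] with t ht
  rw [slope_def_field]
  exact div_nonneg (by linarith [hmin t ht.1.le ht.2]) (by linarith [ht.1])

theorem IsElasticNet.basic {n p : ℕ} {θ lam1 lam2 : ℝ} {x : Fin n → Fin p → ℝ}
    {y : Fin n → ℕ} {b : Fin p → ℝ} (hb : IsElasticNet θ lam1 lam2 x y b) (b' : Fin p → ℝ) :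
    enObjective θ lam1 lam2 x y b ≤ enObjective θ lam1 lam2 x y b' :=
  hb (Set.mem_univ b')

/-- First-order optimality of the elastic net in the direction that averages two coefficients. -/
theorem IsElasticNet.first_order {n p : ℕ} {θ lam1 lam2 : ℝ} {x : Fin n → Fin p → ℝ}
    {y : Fin n → ℕ} {b : Fin p → ℝ} (hθ : 0 < θ) (hlam1 : 0 ≤ lam1)
    (hb : IsElasticNet θ lam1 lam2 x y b) (k l : Fin p) :
    lam2 * (b k - b l) ^ 2 ≤ (b k - b l) / 2 * ((1 / (n : ℝ)) *
      ∑ i, nbScore θ (y i) (x i ⬝ᵥ b) * (x i k - x i l)) := by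
  set d := b k - b l with hd
  set v : Fin p → ℝ := fun j => (d / 2) * ((Pi.single l 1 : Fin p → ℝ) j
      - (Pi.single k 1 : Fin p → ℝ) j) with hv
  have hxv : ∀ i, x i ⬝ᵥ v = -(d / 2) * (x i k - x i l) := by
    intro i
    simp only [dotProduct, hv]
    have : ∀ j, x i j * (d / 2 * ((Pi.single l 1 : Fin p → ℝ) j - (Pi.single k 1 : Fin p → ℝ) j))
        = d / 2 * (x i j * (Pi.single l 1 : Fin p → ℝ) j)
          - d / 2 * (x i j * (Pi.single k 1 : Fin p → ℝ) j) := fun j => by ring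
    simp only [this, Finset.sum_sub_distrib, ← Finset.mul_sum]
    simp [Pi.single_apply]
    ring
  have hbv : ∑ j, 2 * b j * v j = - d ^ 2 := by
    have : ∀ j, 2 * b j * v j = d * (b j * (Pi.single l 1 : Fin p → ℝ) j)
          - d * (b j * (Pi.single k 1 : Fin p → ℝ) j) := fun j => by simp only [hv]; ring
    simp only [this, Finset.sum_sub_distrib, ← Finset.mul_sum]
    simp [Pi.single_apply]
    rw [hd]; ring
  -- The nondifferentiable ℓ¹ term is left out. Minimality passes to the smooth part, since the
  -- omitted term does not increase for `0 ≤ t ≤ 1`.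
  let f : ℝ → ℝ := fun t => (1 / (n : ℝ)) * ∑ i, nbNegLog θ (y i) (x i ⬝ᵥ b + t * (x i ⬝ᵥ v))
    + lam2 * ∑ j, (b j + t * v j) ^ 2
  have hf : HasDerivAt f ((1 / (n : ℝ)) * ∑ i, -nbScore θ (y i) (x i ⬝ᵥ b) * (x i ⬝ᵥ v)
      + lam2 * ∑ j, 2 * b j * v j) 0 := by
    refine HasDerivAt.add (HasDerivAt.const_mul _ (HasDerivAt.fun_sum fun i _ => ?_))
      (HasDerivAt.const_mul _ (HasDerivAt.fun_sum fun j _ => ?_))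
    · have h1 : HasDerivAt (fun t : ℝ => x i ⬝ᵥ b + t * (x i ⬝ᵥ v)) (x i ⬝ᵥ v) 0 := by
        simpa using ((hasDerivAt_id (0 : ℝ)).mul_const (x i ⬝ᵥ v)).const_add (x i ⬝ᵥ b)
      have h2 : HasDerivAt (nbNegLog θ (y i)) (-nbScore θ (y i) (x i ⬝ᵥ b))
          (x i ⬝ᵥ b + 0 * (x i ⬝ᵥ v)) := by
        simpa using hasDerivAt_nbNegLog hθ (y i) (x i ⬝ᵥ b)
      exact HasDerivAt.comp (h₂ := nbNegLog θ (y i)) (0 : ℝ) h2 h1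
    · have h1 : HasDerivAt (fun t : ℝ => b j + t * v j) (v j) 0 := by
        simpa using ((hasDerivAt_id (0 : ℝ)).mul_const (v j)).const_add (b j)
      refine (h1.pow 2).congr_deriv ?_
      simp
  have hmin : ∀ t, 0 ≤ t → t ≤ 1 → f 0 ≤ f t := by
    intro t h0 h1
    have h2 := hb.basic (fun j => b j + t * v j)
    have h3 : ∀ i, x i ⬝ᵥ (fun j => b j + t * v j) = x i ⬝ᵥ b + t * (x i ⬝ᵥ v) := by
      intro i
      simp only [dotProduct, mul_add, Finset.sum_add_distrib, Finset.mul_sum]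
      congr 1
      exact Finset.sum_congr rfl fun j _ => by ring
    have h4 := mul_le_mul_of_nonneg_left (sum_abs_add_average_le b k l h0 h1) hlam1
    simp only [enObjective, nbLoss_eq_sum, h3] at h2
    simp only [f, zero_mul, add_zero]
    simp only [hv] at h2 h4 ⊢
    linarith
  have h := hasDerivAt_nonneg_of_min_right hf hmin
  rw [hbv] at h
  have h5 : ∑ i, -nbScore θ (y i) (x i ⬝ᵥ b) * (x i ⬝ᵥ v)
      = d / 2 * ∑ i, nbScore θ (y i) (x i ⬝ᵥ b) * (x i k - x i l) := by
    rw [Finset.mul_sum]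
    exact Finset.sum_congr rfl fun i _ => by rw [hxv]; ring
  rw [h5] at h
  linarith

/-- The grouping effect: two coefficients of the elastic net differ by at most the correlation
distance of their predictors times the root mean square of the scores. -/
theorem IsElasticNet.grouping {n p : ℕ} {θ lam1 lam2 : ℝ} {x : Fin n → Fin p → ℝ}
    {y : Fin n → ℕ} {b : Fin p → ℝ} (hθ : 0 < θ) (hlam1 : 0 ≤ lam1) (hlam2 : 0 < lam2)
    (hb : IsElasticNet θ lam1 lam2 x y b) (hx : Standardized x) (k l : Fin p) :
    (b k - b l) ^ 2 ≤ 1 / 2 * (1 - empCorr x k l) *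
      (1 / lam2 ^ 2 * ((1 / (n : ℝ)) * ∑ i, nbScore θ (y i) (x i ⬝ᵥ b) ^ 2)) := by
  have hρ := one_sub_empCorr_nonneg hx k l
  have hW : 0 ≤ (1 / (n : ℝ)) * ∑ i, nbScore θ (y i) (x i ⬝ᵥ b) ^ 2 := by positivity
  rcases eq_or_ne (b k) (b l) with hbe | hbe
  · rw [hbe, sub_self]
    exact le_trans (by norm_num) (mul_nonneg (by linarith) (by positivity))
  have h1 := hb.first_order hθ hlam1 k l
  set d := b k - b l
  set S := ∑ i, nbScore θ (y i) (x i ⬝ᵥ b) * (x i k - x i l)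
  have hd : d ≠ 0 := sub_ne_zero.mpr hbe
  have hcs : S ^ 2 ≤ (∑ i, nbScore θ (y i) (x i ⬝ᵥ b) ^ 2) * ∑ i, (x i k - x i l) ^ 2 :=
    Finset.sum_mul_sq_le_sq_mul_sq _ _ _
  set W := ∑ i, nbScore θ (y i) (x i ⬝ᵥ b) ^ 2
  have hcs' : ((1 / (n : ℝ)) * S) ^ 2 ≤ ((1 / (n : ℝ)) * W) * (2 * (1 - empCorr x k l)) := by
    rw [← sum_sq_sub_eq_of_standardized hx k l]
    calc ((1 / (n : ℝ)) * S) ^ 2 = (1 / (n : ℝ)) ^ 2 * S ^ 2 := by ring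
      _ ≤ (1 / (n : ℝ)) ^ 2 * (W * ∑ i, (x i k - x i l) ^ 2) := by gcongr
      _ = _ := by ring
  set s := (1 / (n : ℝ)) * S
  have hd2 : 0 < d ^ 2 := by positivity
  -- Squaring `2 λ₂ d² ≤ d s` makes the sign of `d` irrelevant; then `d²` is cancelled, which is why
  -- `d = 0` was treated apart.
  have h2 : 4 * lam2 ^ 2 * d ^ 2 ≤ s ^ 2 := by
    have h3 : (2 * lam2 * d ^ 2) ^ 2 ≤ (d * s) ^ 2 :=
      pow_le_pow_left₀ (by positivity) (by linarith) 2
    have h4 : (4 * lam2 ^ 2 * d ^ 2) * d ^ 2 ≤ s ^ 2 * d ^ 2 := by nlinarith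
    exact le_of_mul_le_mul_right h4 hd2
  have h5 : d ^ 2 ≤ s ^ 2 / (4 * lam2 ^ 2) := by
    rw [le_div_iff₀ (by positivity)]; linarith
  refine h5.trans ?_
  rw [div_le_iff₀ (by positivity)]
  refine hcs'.trans (le_of_eq ?_)
  field_simp
  ring

/-! ### Slow rate and mean squared score. -/

/-- Tangent inequality with curvature for the loss. -/
theorem nbLoss_quadratic_lower {n p : ℕ} {θ R : ℝ} {x : Fin n → Fin p → ℝ} {y : Fin n → ℕ}
    {b b' : Fin p → ℝ} (hθ : 0 < θ) (hR : ∀ i, |x i ⬝ᵥ b'| ≤ R) (hR' : ∀ i, |x i ⬝ᵥ b| ≤ R) :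
    nbLoss θ x y b' - ∑ j, ((1 / (n : ℝ)) * ∑ i, nbScore θ (y i) (x i ⬝ᵥ b') * x i j)
        * (b j - b' j)
      + nbCurv θ R / 2 * ((1 / (n : ℝ)) * ∑ i, (x i ⬝ᵥ b - x i ⬝ᵥ b') ^ 2)
      ≤ nbLoss θ x y b := by
  have h1 : ∑ j, ((1 / (n : ℝ)) * ∑ i, nbScore θ (y i) (x i ⬝ᵥ b') * x i j) * (b j - b' j)
      = (1 / (n : ℝ)) * ∑ i, nbScore θ (y i) (x i ⬝ᵥ b') * (x i ⬝ᵥ b - x i ⬝ᵥ b') := by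
    simp only [← dotProduct_sub, mul_assoc, Finset.sum_mul, ← Finset.mul_sum]
    rw [Finset.sum_comm]
    simp only [dotProduct, Finset.mul_sum, Pi.sub_apply]
  have h2 : ∑ i, (nbNegLog θ (y i) (x i ⬝ᵥ b')
      - nbScore θ (y i) (x i ⬝ᵥ b') * (x i ⬝ᵥ b - x i ⬝ᵥ b')
      + nbCurv θ R / 2 * (x i ⬝ᵥ b - x i ⬝ᵥ b') ^ 2) ≤ ∑ i, nbNegLog θ (y i) (x i ⬝ᵥ b) :=
    Finset.sum_le_sum fun i _ => nbNegLog_quadratic_lower hθ (by positivity) (hR i) (hR' i)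
  rw [Finset.sum_add_distrib, Finset.sum_sub_distrib, ← Finset.mul_sum] at h2
  have h3 := mul_le_mul_of_nonneg_left h2 (by positivity : (0 : ℝ) ≤ 1 / (n : ℝ))
  rw [h1, nbLoss_eq_sum, nbLoss_eq_sum]
  linarith

theorem abs_dotProduct_le {p : ℕ} {x b : Fin p → ℝ} {L : ℝ} (hx : ∀ j, |x j| ≤ L) :
    |x ⬝ᵥ b| ≤ L * ∑ j, |b j| := by
  rw [dotProduct, Finset.mul_sum]
  refine (Finset.abs_sum_le_sum_abs _ _).trans (Finset.sum_le_sum fun j _ => ?_)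
  rw [abs_mul]
  exact mul_le_mul_of_nonneg_right (hx j) (abs_nonneg _)

theorem sum_abs_le_of_support {p D : ℕ} {b : Fin p → ℝ} {B : ℝ} (hB : 0 ≤ B)
    (hD : (coefSupport b).card ≤ D) (hb : ∀ j, |b j| ≤ B) : ∑ j, |b j| ≤ D * B := by
  have h1 : ∑ j, |b j| = ∑ j ∈ coefSupport b, |b j| := by
    symm
    refine Finset.sum_subset (Finset.subset_univ _) fun j _ hj => ?_
    simpa [coefSupport] using hj
  rw [h1]
  calc _ ≤ ∑ _j ∈ coefSupport b, B := Finset.sum_le_sum fun j _ => hb j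
    _ = (coefSupport b).card * B := by simp
    _ ≤ D * B := by gcongr

/-- Sizes of the elastic net and of its prediction error when the gradient of the loss at the true
coefficients is dominated by the penalty. -/
theorem IsElasticNet.slow_rate {n p D : ℕ} {θ L B lam1 lam2 : ℝ} {x : Fin n → Fin p → ℝ}
    {y : Fin n → ℕ} {b b' : Fin p → ℝ} (hθ : 0 < θ) (hL : 0 < L) (hB : 0 < B) (hlam1 : 0 < lam1)
    (hlam2 : lam2 = lam1 / (8 * B)) (hx : ∀ i j, |x i j| ≤ L) (hb'B : ∀ j, |b' j| ≤ B)
    (hD : (coefSupport b').card ≤ D)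
    (hgrad : ∀ j, |(1 / (n : ℝ)) * ∑ i, nbScore θ (y i) (x i ⬝ᵥ b') * x i j| ≤ lam1 / 2)
    (hb : IsElasticNet θ lam1 lam2 x y b) :
    (∀ i, |x i ⬝ᵥ b| ≤ 4 * (L * (D * B))) ∧
      nbCurv θ (4 * (L * (D * B))) / 2
        * ((1 / (n : ℝ)) * ∑ i, (x i ⬝ᵥ b - x i ⬝ᵥ b') ^ 2) ≤ 13 / 8 * lam1 * (D * B) := by
  have hb'1 := sum_abs_le_of_support hB.le hD hb'B
  have hDB : (0 : ℝ) ≤ D * B := by positivity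
  have hb0 : 0 ≤ ∑ j, |b j| := Finset.sum_nonneg fun j _ => abs_nonneg _
  have hb'0 : 0 ≤ ∑ j, |b' j| := Finset.sum_nonneg fun j _ => abs_nonneg _
  -- The relation `λ₂ = λ₁ / (8 B)` makes the ridge penalty of the true coefficients an eighth of
  -- `λ₁ D B`.
  have hsq : lam2 * ∑ j, b' j ^ 2 ≤ lam1 * (D * B) / 8 := by
    have h1 : ∑ j, b' j ^ 2 ≤ B * (D * B) := by
      calc ∑ j, b' j ^ 2 ≤ ∑ j, B * |b' j| := Finset.sum_le_sum fun j _ => by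
            rw [← sq_abs, sq]
            exact mul_le_mul_of_nonneg_right (hb'B j) (abs_nonneg _)
        _ = B * ∑ j, |b' j| := (Finset.mul_sum _ _ _).symm
        _ ≤ B * (D * B) := by gcongr
    calc lam2 * ∑ j, b' j ^ 2 ≤ lam2 * (B * (D * B)) := by
          have : 0 ≤ lam2 := by rw [hlam2]; positivity
          gcongr
      _ = lam1 * (D * B) / 8 := by rw [hlam2]; field_simp
  have hsq' : 0 ≤ lam2 * ∑ j, b j ^ 2 := by
    rw [hlam2]; positivity
  have hG : ∑ j, ((1 / (n : ℝ)) * ∑ i, nbScore θ (y i) (x i ⬝ᵥ b') * x i j) * (b j - b' j)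
      ≤ lam1 / 2 * (∑ j, |b j| + ∑ j, |b' j|) := by
    rw [← Finset.sum_add_distrib, Finset.mul_sum]
    refine Finset.sum_le_sum fun j _ => (le_abs_self _).trans ?_
    rw [abs_mul]
    exact mul_le_mul (hgrad j) (abs_sub _ _) (abs_nonneg _) (by positivity)
  have hbasic := hb.basic b'
  simp only [enObjective] at hbasic
  have hxb : ∀ i, |x i ⬝ᵥ b| ≤ L * ∑ j, |b j| := fun i => abs_dotProduct_le (hx i)
  have hxb' : ∀ i, |x i ⬝ᵥ b'| ≤ L * ∑ j, |b' j| := fun i => abs_dotProduct_le (hx i)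
  -- The radius may depend on the estimate here, since only the sign of the curvature term matters.
  -- The basic inequality leaves `‖b‖₁ / 2 ≤ (1/2 + 1 + 1/8) D B`, whence `13 / 4`.
  have hb1 : ∑ j, |b j| ≤ 13 / 4 * (D * B) := by
    set R := L * (∑ j, |b j|) + L * (∑ j, |b' j|) with hR
    have h1 := nbLoss_quadratic_lower (R := R) (b := b) (b' := b') (y := y) hθ
      (fun i => (hxb' i).trans (by rw [hR]; nlinarith))
      (fun i => (hxb i).trans (by rw [hR]; nlinarith))
    have h2 : 0 ≤ nbCurv θ R / 2 * ((1 / (n : ℝ)) * ∑ i, (x i ⬝ᵥ b - x i ⬝ᵥ b') ^ 2) := by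
      have := nbCurv_pos hθ R
      positivity
    have h3 : lam1 * ∑ j, |b j| ≤ lam1 * (13 / 4 * (D * B)) := by nlinarith
    exact le_of_mul_le_mul_left h3 hlam1
  -- As `13 / 4 ≤ 4`, the predictors now lie in a deterministic interval. The same inequality can be
  -- used again, this time keeping the curvature term.
  have hR1 : ∀ i, |x i ⬝ᵥ b| ≤ 4 * (L * (D * B)) := fun i => (hxb i).trans (by nlinarith)
  refine ⟨hR1, ?_⟩
  have h1 := nbLoss_quadratic_lower (R := 4 * (L * (D * B))) (b := b) (b' := b') (y := y) hθ
      (fun i => (hxb' i).trans (by nlinarith)) hR1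
  nlinarith

/-- The constant of the slow rate for the mean squared score. -/
noncomputable def slowConst (θ L B : ℝ) (D : ℕ) : ℝ :=
  Real.exp (4 * (L * (D * B))) ^ 2 / (1 - nbShrink θ (4 * (L * (D * B))))
    * (13 / 4 * (D * B) / nbCurv θ (4 * (L * (D * B)))) * (8 * B)

/-- The constant of the grouping inequality. -/
noncomputable def groupConst (θ L B : ℝ) (D : ℕ) : ℝ :=
  slowConst θ L B D ^ 2
    / (4 * (1 - nbShrink θ (4 * (L * (D * B)))) * varBound θ L B)

theorem varBound_pos {θ L B : ℝ} (hθ : 0 < θ) : 0 < varBound θ L B := by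
  unfold varBound; positivity

theorem groupConst_nonneg {θ L B : ℝ} (D : ℕ) (hθ : 0 < θ) : 0 ≤ groupConst θ L B D := by
  have h1 := nbShrink_lt_one hθ (4 * (L * (D * B)))
  have h2 := varBound_pos (L := L) (B := B) hθ
  have : 0 < 1 - nbShrink θ (4 * (L * (D * B))) := by linarith
  unfold groupConst
  positivity

/-- The squared residuals carry the coefficient `s < 1`, so of the allowed `E + μ` at least `(1 - s)
μ` is unspent. It absorbs the prediction error, which is only linear in `λ₂`. -/
theorem IsElasticNet.mean_score_sq_le {n p D : ℕ} {θ L B E lam1 lam2 : ℝ}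
    {x : Fin n → Fin p → ℝ} {y : Fin n → ℕ} {b b' : Fin p → ℝ} (hθ : 0 < θ) (hL : 0 < L)
    (hB : 0 < B) (hE : 0 < E) (hlam1 : 0 < lam1)
    (hlam2 : lam2 = lam1 / (8 * B)) (hx : ∀ i j, |x i j| ≤ L) (hb'B : ∀ j, |b' j| ≤ B)
    (hD : (coefSupport b').card ≤ D)
    (hgrad : ∀ j, |(1 / (n : ℝ)) * ∑ i, nbScore θ (y i) (x i ⬝ᵥ b') * x i j| ≤ lam1 / 2)
    (hres : (1 / (n : ℝ)) * ∑ i, ((y i : ℝ) - Real.exp (x i ⬝ᵥ b')) ^ 2 ≤ E + varBound θ L B)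
    (hb : IsElasticNet θ lam1 lam2 x y b) :
    (1 / (n : ℝ)) * ∑ i, nbScore θ (y i) (x i ⬝ᵥ b) ^ 2
      ≤ lam2 ^ 2 * groupConst θ L B D + (E + varBound θ L B) := by
  obtain ⟨hR, hΔ⟩ := hb.slow_rate hθ hL hB hlam1 hlam2 hx hb'B hD hgrad
  have hμ := varBound_pos (L := L) (B := B) hθ
  have hR' : ∀ i, |x i ⬝ᵥ b'| ≤ 4 * (L * (D * B)) := fun i =>
    (abs_dotProduct_le (hx i)).trans (by
      have := sum_abs_le_of_support hB.le hD hb'B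
      have h0 : (0 : ℝ) ≤ D * B := by positivity
      nlinarith)
  have hlam1' : lam1 = lam2 * (8 * B) := by rw [hlam2]; field_simp
  rw [groupConst, slowConst]
  set R := 4 * (L * (D * B)) with hRdef
  set s := nbShrink θ R
  have hs1 : s < 1 := nbShrink_lt_one hθ R
  have hs0 : 0 < s := nbShrink_pos hθ R
  have hc := nbCurv_pos hθ R
  set V := (1 / (n : ℝ)) * ∑ i, (x i ⬝ᵥ b - x i ⬝ᵥ b') ^ 2
  set U := (1 / (n : ℝ)) * ∑ i, ((y i : ℝ) - Real.exp (x i ⬝ᵥ b')) ^ 2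
  have h1s : 0 < 1 - s := by linarith
  have hV : V ≤ 13 / 4 * (D * B) / nbCurv θ R * lam1 := by
    rw [div_mul_eq_mul_div, le_div_iff₀ hc]
    linarith
  have h1 : (1 / (n : ℝ)) * ∑ i, nbScore θ (y i) (x i ⬝ᵥ b) ^ 2
      ≤ s * U + Real.exp R ^ 2 / (1 - s) * V := by
    have h2 : ∑ i, nbScore θ (y i) (x i ⬝ᵥ b) ^ 2
        ≤ ∑ i, (s * ((y i : ℝ) - Real.exp (x i ⬝ᵥ b')) ^ 2
          + Real.exp R ^ 2 / (1 - s) * (x i ⬝ᵥ b - x i ⬝ᵥ b') ^ 2) :=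
      Finset.sum_le_sum fun i _ => nbScore_sq_le hθ (hR' i) (hR i)
    rw [Finset.sum_add_distrib, ← Finset.mul_sum, ← Finset.mul_sum] at h2
    have h3 := mul_le_mul_of_nonneg_left h2 (by positivity : (0 : ℝ) ≤ 1 / (n : ℝ))
    simp only [U, V]
    linarith
  have h2 : Real.exp R ^ 2 / (1 - s) * V
      ≤ Real.exp R ^ 2 / (1 - s) * (13 / 4 * (D * B) / nbCurv θ R * lam1) := by gcongr
  set Q := Real.exp R ^ 2 / (1 - s) * (13 / 4 * (D * B) / nbCurv θ R) * (8 * B) with hQ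
  have h3 : Real.exp R ^ 2 / (1 - s) * (13 / 4 * (D * B) / nbCurv θ R * lam1) = Q * lam2 := by
    rw [hQ, hlam1']; ring
  -- Completing the square with `w = (1 - s) μ`; this determines the value of `groupConst`.
  have h4 : Q * lam2 ≤ lam2 ^ 2 * (Q ^ 2 / (4 * (1 - s) * varBound θ L B))
      + (1 - s) * varBound θ L B := by
    set w := (1 - s) * varBound θ L B with hw
    have hw0 : 0 < w := by positivity
    have h5 : lam2 ^ 2 * (Q ^ 2 / (4 * (1 - s) * varBound θ L B)) + w - Q * lam2
        = (lam2 * Q - 2 * w) ^ 2 / (4 * w) := by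
      rw [show 4 * (1 - s) * varBound θ L B = 4 * w by rw [hw]; ring]
      field_simp
      ring
    have h6 : 0 ≤ (lam2 * Q - 2 * w) ^ 2 / (4 * w) := by positivity
    linarith
  have h5 : s * U ≤ s * (E + varBound θ L B) := by gcongr
  nlinarith

theorem IsElasticNet.grouping_oracle {n p D : ℕ} {θ L B E lam1 lam2 : ℝ}
    {x : Fin n → Fin p → ℝ} {y : Fin n → ℕ} {b b' : Fin p → ℝ} (hθ : 0 < θ) (hL : 0 < L)
    (hB : 0 < B) (hE : 0 < E) (hlam1 : 0 < lam1)
    (hlam2 : lam2 = lam1 / (8 * B)) (hx : ∀ i j, |x i j| ≤ L) (hb'B : ∀ j, |b' j| ≤ B)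
    (hD : (coefSupport b').card ≤ D)
    (hgrad : ∀ j, |(1 / (n : ℝ)) * ∑ i, nbScore θ (y i) (x i ⬝ᵥ b') * x i j| ≤ lam1 / 2)
    (hres : (1 / (n : ℝ)) * ∑ i, ((y i : ℝ) - Real.exp (x i ⬝ᵥ b')) ^ 2 ≤ E + varBound θ L B)
    (hb : IsElasticNet θ lam1 lam2 x y b) (hstd : Standardized x) (k l : Fin p) :
    (b k - b l) ^ 2 ≤ 1 / 2 * ((1 - empCorr x k l) / lam2 ^ 2)
      * (lam2 ^ 2 * groupConst θ L B D + (E + varBound θ L B)) := by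
  have hlam2' : 0 < lam2 := by rw [hlam2]; positivity
  have h1 := hb.grouping hθ hlam1.le hlam2' hstd k l
  have h2 := hb.mean_score_sq_le hθ hL hB hE hlam1 hlam2 hx hb'B hD hgrad hres
  have h3 := one_sub_empCorr_nonneg hstd k l
  refine h1.trans ?_
  calc _ = 1 / 2 * ((1 - empCorr x k l) / lam2 ^ 2)
      * ((1 / (n : ℝ)) * ∑ i, nbScore θ (y i) (x i ⬝ᵥ b) ^ 2) := by ring
    _ ≤ _ := by gcongr

/-! ### Mass function, moments and moment generating function of the negative binomial law. -/

theorem nbPMF_pos {θ m : ℝ} (hθ : 0 < θ) (hm : 0 < m) (y : ℕ) : 0 < nbPMF θ m y := by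
  have h1 : 0 < Real.Gamma (θ + y) := Real.Gamma_pos_of_pos (by positivity)
  have h2 : 0 < Real.Gamma θ := Real.Gamma_pos_of_pos hθ
  unfold nbPMF
  positivity

theorem nbPMF_succ {θ m : ℝ} (hθ : 0 < θ) (y : ℕ) :
    ((y : ℝ) + 1) * nbPMF θ m (y + 1) = m / (θ + m) * ((θ + y) * nbPMF θ m y) := by
  have h2 : 0 < Real.Gamma θ := Real.Gamma_pos_of_pos hθ
  have h3 : Real.Gamma (θ + ((y + 1 : ℕ) : ℝ)) = (θ + y) * Real.Gamma (θ + y) := by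
    rw [← Real.Gamma_add_one (by positivity)]
    push_cast
    ring_nf
  unfold nbPMF
  rw [h3, Nat.factorial_succ, pow_succ]
  push_cast
  generalize m / (θ + m) = q
  field_simp

theorem ringChoose_eq_gamma {θ : ℝ} (hθ : 0 < θ) (y : ℕ) :
    Ring.choose (θ + y - 1) y = Real.Gamma (θ + y) / (Real.Gamma θ * (y.factorial : ℝ)) := by
  have h2 : 0 < Real.Gamma θ := Real.Gamma_pos_of_pos hθ
  rw [← Ring.multichoose_eq]
  have h1 := Ring.factorial_nsmul_multichoose_eq_ascPochhammer θ y
  rw [Polynomial.ascPochhammer_smeval_eq_eval, nsmul_eq_mul] at h1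
  have h3 : ∀ y : ℕ, (ascPochhammer ℝ y).eval θ * Real.Gamma θ = Real.Gamma (θ + y) := by
    intro y
    induction y with
    | zero => simp
    | succ y ih =>
      rw [ascPochhammer_succ_eval]
      push_cast
      rw [← add_assoc, Real.Gamma_add_one (by positivity), ← ih]
      ring
  rw [← h3, ← h1]
  have : (y.factorial : ℝ) ≠ 0 := by positivity
  field_simp

/-- This is the binomial series of `(1 - q)^(-θ)` at `q = m / (θ + m)`, whose coefficients
`ringChoose_eq_gamma` writes as Gamma quotients. -/
theorem hasSum_nbPMF {θ m : ℝ} (hθ : 0 < θ) (hm : 0 < m) : HasSum (nbPMF θ m) 1 := by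
  have hq0 : 0 ≤ m / (θ + m) := by positivity
  have hq1 : m / (θ + m) < 1 := by rw [div_lt_one (by positivity)]; linarith
  have h1 := (Real.one_div_one_sub_rpow_hasFPowerSeriesOnBall_zero θ).hasSum
    (y := m / (θ + m)) (by
      simp only [Metric.mem_eball, edist_zero_right]
      rw [Real.enorm_of_nonneg hq0, ENNReal.ofReal_lt_one]
      exact hq1)
  have h4 : 1 - m / (θ + m) = θ / (θ + m) := by field_simp; ring
  have h2 := h1.mul_right ((θ / (θ + m)) ^ θ)
  have h5 : (0 : ℝ) < (θ / (θ + m)) ^ θ := by positivity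
  rw [zero_add, h4, one_div, inv_mul_cancel₀ h5.ne'] at h2
  refine h2.congr_fun ?_
  intro y
  simp [FormalMultilinearSeries.ofScalars, ringChoose_eq_gamma hθ, nbPMF]

section Moments

variable {θ m : ℝ}

/-- Stein's identity for the negative binomial law. -/
theorem nbPMF_stein (hθ : 0 < θ) {g : ℕ → ℝ} {a b : ℝ}
    (h1 : HasSum (fun y : ℕ => (y : ℝ) * g y * nbPMF θ m y) a)
    (h2 : HasSum (fun y : ℕ => (θ + y) * g (y + 1) * nbPMF θ m y) b) :
    a = m / (θ + m) * b := by
  -- The term at `y = 0` vanishes, so the sum can be shifted and matched with the recursion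
  -- `nbPMF_succ`.
  have h3 := (hasSum_nat_add_iff' 1).mpr h1
  simp only [Finset.range_one, Finset.sum_singleton, Nat.cast_zero, zero_mul, sub_zero] at h3
  refine h3.unique ?_
  refine (h2.mul_left (m / (θ + m))).congr_fun fun y => ?_
  push_cast
  linear_combination (g (y + 1)) * nbPMF_succ (m := m) hθ y

/-- Stein's identity for `g y = y ^ (q - 1)`, with `(y + 1) ^ (q - 1)` expanded, has the `q`-th
moment on both sides. Clearing `θ + m` leaves a recursion in the lower moments. -/
theorem nb_moments (hθ : 0 < θ) (hm : 0 < m)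
    (hs : ∀ q : ℕ, 1 ≤ q → Summable fun y : ℕ => (y : ℝ) ^ q * nbPMF θ m y) :
    ∃ M₂ M₃ M₄ : ℝ, HasSum (fun y : ℕ => (y : ℝ) * nbPMF θ m y) m ∧
      HasSum (fun y : ℕ => (y : ℝ) ^ 2 * nbPMF θ m y) M₂ ∧
      HasSum (fun y : ℕ => (y : ℝ) ^ 3 * nbPMF θ m y) M₃ ∧
      HasSum (fun y : ℕ => (y : ℝ) ^ 4 * nbPMF θ m y) M₄ ∧
      θ * M₂ = m * (θ + (θ + 1) * m) ∧
      θ * M₃ = m * (θ + (2 * θ + 1) * m + (θ + 2) * M₂) ∧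
      θ * M₄ = m * (θ + (3 * θ + 1) * m + (3 * θ + 3) * M₂ + (θ + 3) * M₃) := by
  have h0 := hasSum_nbPMF hθ hm
  have h1 := (hs 1 le_rfl).hasSum
  have h2 := (hs 2 (by norm_num)).hasSum
  have h3 := (hs 3 (by norm_num)).hasSum
  have h4 := (hs 4 (by norm_num)).hasSum
  simp only [pow_one] at h1
  set M₁ := ∑' y : ℕ, (y : ℝ) * nbPMF θ m y
  set M₂ := ∑' y : ℕ, (y : ℝ) ^ 2 * nbPMF θ m y
  set M₃ := ∑' y : ℕ, (y : ℝ) ^ 3 * nbPMF θ m y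
  set M₄ := ∑' y : ℕ, (y : ℝ) ^ 4 * nbPMF θ m y
  have e1 := nbPMF_stein (g := fun _ => 1) hθ (h1.congr_fun fun y => by ring)
    (((h0.mul_left θ).add h1).congr_fun fun y => by ring)
  have e2 := nbPMF_stein (g := fun y => (y : ℝ)) hθ (h2.congr_fun fun y => by ring)
    ((((h0.mul_left θ).add (h1.mul_left (θ + 1))).add h2).congr_fun fun y => by
      push_cast; ring)
  have e3 := nbPMF_stein (g := fun y => (y : ℝ) ^ 2) hθ (h3.congr_fun fun y => by ring)
    (((((h0.mul_left θ).add (h1.mul_left (2 * θ + 1))).add (h2.mul_left (θ + 2))).add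
      h3).congr_fun fun y => by push_cast; ring)
  have e4 := nbPMF_stein (g := fun y => (y : ℝ) ^ 3) hθ (h4.congr_fun fun y => by ring)
    ((((((h0.mul_left θ).add (h1.mul_left (3 * θ + 1))).add (h2.mul_left (3 * θ + 3))).add
      (h3.mul_left (θ + 3))).add h4).congr_fun fun y => by push_cast; ring)
  have hne : θ + m ≠ 0 := by positivity
  rw [div_mul_eq_mul_div, eq_div_iff hne] at e1 e2 e3 e4
  have hM1 : M₁ = m := by
    have : θ * M₁ = θ * m := by linarith
    exact mul_left_cancel₀ hθ.ne' this
  rw [hM1] at e2 e3 e4 h1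
  exact ⟨M₂, M₃, M₄, h1, h2, h3, h4, by linarith, by linarith, by linarith⟩

theorem hasSum_nb_variance (hθ : 0 < θ) (hm : 0 < m)
    (hs : ∀ q : ℕ, 1 ≤ q → Summable fun y : ℕ => (y : ℝ) ^ q * nbPMF θ m y) :
    HasSum (fun y : ℕ => ((y : ℝ) - m) ^ 2 * nbPMF θ m y) (m * (θ + m) / θ) := by
  obtain ⟨M₂, M₃, M₄, h1, h2, h3, h4, e2, e3, e4⟩ := nb_moments hθ hm hs
  have h0 := hasSum_nbPMF hθ hm
  have h := ((h2.add (h1.mul_left (-2 * m))).add (h0.mul_left (m ^ 2))).congr_fun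
    (g := fun y : ℕ => ((y : ℝ) - m) ^ 2 * nbPMF θ m y) fun y => by ring
  convert h using 1
  rw [div_eq_iff hθ.ne']
  linear_combination -e2

/-- An exact value, increasing in the variance `m (θ + m) / θ`; `sqVarBound` is its value at the
largest mean `e^{LB}`. -/
theorem hasSum_nb_sq_variance (hθ : 0 < θ) (hm : 0 < m)
    (hs : ∀ q : ℕ, 1 ≤ q → Summable fun y : ℕ => (y : ℝ) ^ q * nbPMF θ m y) :
    HasSum (fun y : ℕ => (((y : ℝ) - m) ^ 2 - m * (θ + m) / θ) ^ 2 * nbPMF θ m y)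
      ((2 + 6 / θ) * (m * (θ + m) / θ) ^ 2 + m * (θ + m) / θ) := by
  obtain ⟨M₂, M₃, M₄, h1, h2, h3, h4, e2, e3, e4⟩ := nb_moments hθ hm hs
  have h0 := hasSum_nbPMF hθ hm
  set v := m * (θ + m) / θ with hv
  have h := ((((h4.add (h3.mul_left (-4 * m))).add (h2.mul_left (6 * m ^ 2 - 2 * v))).add
    (h1.mul_left (-4 * m ^ 3 + 4 * m * v))).add (h0.mul_left (m ^ 4 - 2 * v * m ^ 2 + v ^ 2))).congr_fun
    (g := fun y : ℕ => (((y : ℝ) - m) ^ 2 - v) ^ 2 * nbPMF θ m y) fun y => by ring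
  convert h using 1
  have f2 : M₂ = m * (θ + (θ + 1) * m) / θ := by rw [eq_div_iff hθ.ne']; linarith
  have f3 : M₃ = m * (θ + (2 * θ + 1) * m + (θ + 2) * M₂) / θ := by
    rw [eq_div_iff hθ.ne']; linarith
  have f4 : M₄ = m * (θ + (3 * θ + 1) * m + (3 * θ + 3) * M₂ + (θ + 3) * M₃) / θ := by
    rw [eq_div_iff hθ.ne']; linarith
  rw [f4, f3, f2, hv]
  field_simp
  ring

/-- The linear term keeps its sign so that centring can cancel it; the tail is made nonnegative so
that sums can be interchanged. -/
theorem exp_le_one_add_add_tsum (x : ℝ) :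
    Real.exp x ≤ 1 + x + ∑' q : ℕ, |x| ^ (q + 2) / ((q + 2).factorial : ℝ) := by
  have h1 := (Real.summable_pow_div_factorial x).sum_add_tsum_nat_add 2
  have h2 : Real.exp x = ∑' q : ℕ, x ^ q / (q.factorial : ℝ) := by
    rw [Real.exp_eq_exp_ℝ, NormedSpace.exp_eq_tsum_div]
  rw [h2, ← h1]
  simp only [Finset.sum_range_succ, Finset.sum_range_zero, pow_zero, pow_one, Nat.factorial]
  have h3 : ∑' q : ℕ, x ^ (q + 2) / ((q + 2).factorial : ℝ)
      ≤ ∑' q : ℕ, |x| ^ (q + 2) / ((q + 2).factorial : ℝ) := by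
    refine Summable.tsum_le_tsum (fun q => ?_)
      ((summable_nat_add_iff 2).mpr (Real.summable_pow_div_factorial x))
      ((summable_nat_add_iff 2).mpr (Real.summable_pow_div_factorial |x|))
    exact div_le_div_of_nonneg_right (by rw [← abs_pow]; exact le_abs_self _) (by positivity)
  simp only [Nat.factorial] at h3 ⊢
  norm_num
  norm_num at h3
  linarith

/-- Sub-exponential bound for the centred moment generating function of a negative binomial law
whose moments are bounded by `q! C ^ q`. -/
theorem nb_mgf_le (hθ : 0 < θ) (hm : 0 < m) {C a : ℝ} (hC : 0 < C)
    (hs : ∀ q : ℕ, 1 ≤ q → Summable (fun y : ℕ => (y : ℝ) ^ q * nbPMF θ m y) ∧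
      ∑' y : ℕ, (y : ℝ) ^ q * nbPMF θ m y ≤ (q.factorial : ℝ) * C ^ q)
    (ha : |a| * C ≤ 1 / 2) :
    Summable (fun y : ℕ => Real.exp (a * ((y : ℝ) - m)) * nbPMF θ m y) ∧
      ∑' y : ℕ, Real.exp (a * ((y : ℝ) - m)) * nbPMF θ m y ≤ Real.exp (4 * (a * C) ^ 2) := by
  obtain ⟨M₂, M₃, M₄, h1, -⟩ := nb_moments hθ hm fun q hq => (hs q hq).1
  have h0 := hasSum_nbPMF hθ hm
  have hmC : m ≤ C := by
    have := (hs 1 le_rfl).2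
    simp only [pow_one] at this
    rw [h1.tsum_eq] at this
    simpa using this
  have hf := nbPMF_pos hθ hm
  set z := |a| * C with hz
  have hz0 : 0 ≤ z := by positivity
  -- A nonnegative majorant of the tail of the exponential series, indexed by power and count.
  -- Summed over counts, the factorials cancel and a geometric series in `z ≤ 1 / 2` remains.
  let F : ℕ × ℕ → ℝ := fun r =>
    |a| ^ (r.1 + 2) * (((r.2 : ℝ) ^ (r.1 + 2) + m ^ (r.1 + 2)) * nbPMF θ m r.2)
      / ((r.1 + 2).factorial : ℝ)
  have hF0 : ∀ r, 0 ≤ F r := fun r => by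
    have := hf r.2
    simp only [F]
    positivity
  have hFq : ∀ q : ℕ, HasSum (fun y => F (q, y)) (|a| ^ (q + 2) *
      (∑' y : ℕ, (y : ℝ) ^ (q + 2) * nbPMF θ m y + m ^ (q + 2)) / ((q + 2).factorial : ℝ)) := by
    intro q
    have h2 := (((hs (q + 2) (by omega)).1.hasSum.add (h0.mul_left (m ^ (q + 2)))).mul_left
      (|a| ^ (q + 2))).div_const ((q + 2).factorial : ℝ)
    rw [mul_one] at h2
    exact h2.congr_fun fun y => by simp only [F]; ring
  have hle : ∀ q : ℕ, ∑' y, F (q, y) ≤ 2 * z ^ 2 * z ^ q := by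
    intro q
    rw [(hFq q).tsum_eq, div_le_iff₀ (by positivity)]
    have h2 := (hs (q + 2) (by omega)).2
    have h3 : m ^ (q + 2) ≤ ((q + 2).factorial : ℝ) * C ^ (q + 2) := by
      have h4 : m ^ (q + 2) ≤ C ^ (q + 2) := pow_le_pow_left₀ hm.le hmC _
      have h5 : (1 : ℝ) ≤ ((q + 2).factorial : ℝ) := by
        exact_mod_cast Nat.one_le_iff_ne_zero.mpr (Nat.factorial_ne_zero _)
      nlinarith [pow_pos hC (q + 2)]
    calc |a| ^ (q + 2) * (∑' y : ℕ, (y : ℝ) ^ (q + 2) * nbPMF θ m y + m ^ (q + 2))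
        ≤ |a| ^ (q + 2) * (((q + 2).factorial : ℝ) * C ^ (q + 2)
          + ((q + 2).factorial : ℝ) * C ^ (q + 2)) := by gcongr
      _ = 2 * z ^ 2 * z ^ q * ((q + 2).factorial : ℝ) := by
        rw [hz, mul_pow, mul_pow]; ring
  have hgeo : HasSum (fun q : ℕ => 2 * z ^ 2 * z ^ q) (2 * z ^ 2 * (1 - z)⁻¹) :=
    (hasSum_geometric_of_lt_one hz0 (by linarith)).mul_left _
  have hsumm : Summable F := by
    rw [summable_prod_of_nonneg hF0]
    exact ⟨fun q => (hFq q).summable, Summable.of_nonneg_of_le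
      (fun q => tsum_nonneg fun y => hF0 _) hle hgeo.summable⟩
  have hsw : Summable (Function.uncurry fun q y => F (q, y)) := hsumm
  have hsy : Summable fun y => ∑' q, F (q, y) := hsw.prod_symm.prod
  have htot : ∑' y, ∑' q, F (q, y) ≤ 4 * z ^ 2 := by
    rw [hsw.tsum_comm]
    refine (Summable.tsum_le_tsum hle hsw.prod hgeo.summable).trans ?_
    rw [hgeo.tsum_eq]
    have : (1 - z)⁻¹ ≤ 2 := by
      rw [inv_le_comm₀ (by linarith) (by norm_num)]; linarith
    nlinarith [sq_nonneg z]
  have hpt : ∀ y : ℕ, Real.exp (a * ((y : ℝ) - m)) * nbPMF θ m y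
      ≤ (nbPMF θ m y + a * ((y : ℝ) * nbPMF θ m y - m * nbPMF θ m y)) + ∑' q, F (q, y) := by
    intro y
    have h2 := exp_le_one_add_add_tsum (a * ((y : ℝ) - m))
    have h3 : (∑' q : ℕ, |a * ((y : ℝ) - m)| ^ (q + 2) / ((q + 2).factorial : ℝ)) * nbPMF θ m y
        ≤ ∑' q, F (q, y) := by
      rw [← tsum_mul_right]
      refine Summable.tsum_le_tsum (fun q => ?_) (((summable_nat_add_iff 2).mpr
        (Real.summable_pow_div_factorial |a * ((y : ℝ) - m)|)).mul_right _)
        (hsw.prod_symm.prod_factor y)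
      have h4 : |(y : ℝ) - m| ^ (q + 2) ≤ (y : ℝ) ^ (q + 2) + m ^ (q + 2) := by
        have hy : (0 : ℝ) ≤ y := by positivity
        have h6 := pow_nonneg hy (q + 2)
        have h7 := pow_nonneg hm.le (q + 2)
        rcases le_total (y : ℝ) m with h5 | h5
        · have : |(y : ℝ) - m| ^ (q + 2) ≤ m ^ (q + 2) :=
            pow_le_pow_left₀ (abs_nonneg _) (by rw [abs_le]; constructor <;> linarith) _
          linarith
        · have : |(y : ℝ) - m| ^ (q + 2) ≤ (y : ℝ) ^ (q + 2) :=
            pow_le_pow_left₀ (abs_nonneg _) (by rw [abs_le]; constructor <;> linarith) _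
          linarith
      simp only [F]
      rw [abs_mul, mul_pow, div_mul_eq_mul_div, mul_assoc]
      have := (hf y).le
      gcongr
    have h4 := mul_le_mul_of_nonneg_right h2 (hf y).le
    linarith
  -- The linear term sums to zero because the mean is `m`.
  have hlin := (h0.add ((h1.sub (h0.mul_left m)).mul_left a)).add hsy.hasSum
  have hsum : Summable (fun y : ℕ => Real.exp (a * ((y : ℝ) - m)) * nbPMF θ m y) :=
    Summable.of_nonneg_of_le (fun y => mul_nonneg (Real.exp_pos _).le (hf y).le) hpt hlin.summable
  refine ⟨hsum, ?_⟩
  refine (Summable.tsum_le_tsum hpt hsum hlin.summable).trans ?_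
  rw [hlin.tsum_eq]
  have h5 := Real.add_one_le_exp (4 * (a * C) ^ 2)
  have h6 : z ^ 2 = (a * C) ^ 2 := by rw [hz, mul_pow, mul_pow, sq_abs]
  rw [h6] at htot
  linarith

end Moments

/-! ### Integration against the conditional law of the response. -/

section CondLaw

variable {Ω E : Type*} [MeasurableSpace Ω] [MeasurableSpace E] {P : Measure Ω}
  [IsProbabilityMeasure P] {X : Ω → E} {Y : Ω → ℕ} {f : E → ℕ → ℝ}

/-- The law of `X` restricted to `Y = y` and the pushforward of the density `f (X ω) y` agree on
every measurable set, by the defining property of conditional expectation. Both sides integrate `g`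
against this common measure. -/
theorem setLIntegral_of_condLaw (hX : Measurable X) (hY : Measurable Y)
    (hf : ∀ y, Measurable fun x => f x y) (hf0 : ∀ x y, 0 ≤ f x y)
    (hlaw : ∀ y : ℕ, P⟦Y ⁻¹' {y} | MeasurableSpace.comap X inferInstance⟧
      =ᵐ[P] fun ω => f (X ω) y)
    {g : E → ENNReal} (hg : Measurable g) (y : ℕ) :
    ∫⁻ ω in Y ⁻¹' {y}, g (X ω) ∂P = ∫⁻ ω, g (X ω) * ENNReal.ofReal (f (X ω) y) ∂P := by
  have hYm : MeasurableSet (Y ⁻¹' {y}) := hY (measurableSet_singleton y)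
  have hfX : Measurable fun ω => ENNReal.ofReal (f (X ω) y) := ((hf y).comp hX).ennreal_ofReal
  have hint : Integrable (fun ω => f (X ω) y) P := integrable_condExp.congr (hlaw y)
  have hmeas : (P.restrict (Y ⁻¹' {y})).map X
      = (P.withDensity fun ω => ENNReal.ofReal (f (X ω) y)).map X := by
    ext A hA
    have hA' : MeasurableSet (X ⁻¹' A) := hX hA
    rw [Measure.map_apply hX hA, Measure.map_apply hX hA, Measure.restrict_apply hA',
      withDensity_apply _ hA', ← ofReal_integral_eq_lintegral_ofReal hint.restrict
        (ae_of_all _ fun ω => hf0 _ _)]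
    have h1 : ∫ ω in X ⁻¹' A, f (X ω) y ∂P = ∫ ω in X ⁻¹' A,
        (P⟦Y ⁻¹' {y} | MeasurableSpace.comap X inferInstance⟧) ω ∂P :=
      setIntegral_congr_ae hA' ((hlaw y).mono fun ω h _ => h.symm)
    rw [h1, setIntegral_condExp hX.comap_le ((integrable_const _).indicator hYm) ⟨A, hA, rfl⟩,
      setIntegral_indicator hYm]
    simp
  have h2 : ∫⁻ ω in Y ⁻¹' {y}, g (X ω) ∂P = ∫⁻ x, g x ∂((P.restrict (Y ⁻¹' {y})).map X) :=
    (lintegral_map hg hX).symm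
  rw [h2, hmeas, lintegral_map hg hX]
  exact (lintegral_withDensity_eq_lintegral_mul P hfX (hg.comp hX)).trans
    (lintegral_congr fun ω => mul_comm _ _)

theorem lintegral_of_condLaw (hX : Measurable X) (hY : Measurable Y)
    (hf : ∀ y, Measurable fun x => f x y) (hf0 : ∀ x y, 0 ≤ f x y)
    (hlaw : ∀ y : ℕ, P⟦Y ⁻¹' {y} | MeasurableSpace.comap X inferInstance⟧
      =ᵐ[P] fun ω => f (X ω) y)
    {g : E → ℕ → ENNReal} (hg : ∀ y, Measurable fun x => g x y) :
    ∫⁻ ω, g (X ω) (Y ω) ∂P = ∫⁻ ω, ∑' y, g (X ω) y * ENNReal.ofReal (f (X ω) y) ∂P := by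
  have hsm : ∀ y, AEMeasurable (fun ω => g (X ω) y * ENNReal.ofReal (f (X ω) y)) P := fun y =>
    (((hg y).comp hX).mul ((hf y).comp hX).ennreal_ofReal).aemeasurable
  rw [lintegral_tsum hsm]
  have hYm : ∀ y, MeasurableSet (Y ⁻¹' {y}) := fun y => hY (measurableSet_singleton y)
  have hU : (⋃ y, Y ⁻¹' {y}) = Set.univ := by ext; simp
  have hdisj : Pairwise (Function.onFun Disjoint fun y => Y ⁻¹' {y}) := by
    intro a b hab
    exact Disjoint.preimage Y (by simpa using hab)
  rw [← setLIntegral_univ, ← hU, lintegral_iUnion hYm hdisj]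
  refine tsum_congr fun y => ?_
  rw [← setLIntegral_of_condLaw hX hY hf hf0 hlaw (hg y) y]
  refine setLIntegral_congr_fun (hYm y) fun ω hω => ?_
  simp only [Set.mem_preimage, Set.mem_singleton_iff] at hω
  simp only [hω]

/-- Conditional expectations given the covariate bound expectations. -/
theorem integral_le_of_condLaw (hX : Measurable X) (hY : Measurable Y)
    (hf : ∀ y, Measurable fun x => f x y) (hf0 : ∀ x y, 0 ≤ f x y)
    (hlaw : ∀ y : ℕ, P⟦Y ⁻¹' {y} | MeasurableSpace.comap X inferInstance⟧
      =ᵐ[P] fun ω => f (X ω) y)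
    {g : E → ℕ → ℝ} (hg : ∀ y, Measurable fun x => g x y) (hg0 : ∀ x y, 0 ≤ g x y) {c : ℝ}
    (hc0 : 0 ≤ c) (hc : ∀ᵐ ω ∂P, Summable (fun y => g (X ω) y * f (X ω) y) ∧
      ∑' y, g (X ω) y * f (X ω) y ≤ c) :
    Integrable (fun ω => g (X ω) (Y ω)) P ∧ ∫ ω, g (X ω) (Y ω) ∂P ≤ c := by
  have hgm : Measurable fun ω => g (X ω) (Y ω) :=
    (measurable_from_prod_countable_left (f := fun q : E × ℕ => g q.1 q.2) hg).comp (hX.prodMk hY)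
  have h1 : ∫⁻ ω, ENNReal.ofReal (g (X ω) (Y ω)) ∂P ≤ ENNReal.ofReal c := by
    rw [lintegral_of_condLaw (g := fun x y => ENNReal.ofReal (g x y)) hX hY hf hf0 hlaw
      fun y => (hg y).ennreal_ofReal]
    calc _ ≤ ∫⁻ _ω, ENNReal.ofReal c ∂P := by
          refine lintegral_mono_ae (hc.mono fun ω hω => ?_)
          simp only [← ENNReal.ofReal_mul (hg0 _ _)]
          rw [← ENNReal.ofReal_tsum_of_nonneg (fun y => mul_nonneg (hg0 _ _) (hf0 _ _)) hω.1]
          exact ENNReal.ofReal_le_ofReal hω.2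
      _ = ENNReal.ofReal c := by simp
  refine ⟨⟨hgm.aestronglyMeasurable, ?_⟩, ?_⟩
  · rw [hasFiniteIntegral_iff_ofReal (ae_of_all _ fun ω => hg0 _ _)]
    exact h1.trans_lt ENNReal.ofReal_lt_top
  · rw [integral_eq_lintegral_of_nonneg_ae (ae_of_all _ fun ω => hg0 _ _)
      hgm.aestronglyMeasurable]
    exact ENNReal.toReal_le_of_le_ofReal hc0 h1

/-- The tower property for nonnegative functions. -/
theorem integral_eq_of_condLaw (hX : Measurable X) (hY : Measurable Y)
    (hf : ∀ y, Measurable fun x => f x y) (hf0 : ∀ x y, 0 ≤ f x y)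
    (hlaw : ∀ y : ℕ, P⟦Y ⁻¹' {y} | MeasurableSpace.comap X inferInstance⟧
      =ᵐ[P] fun ω => f (X ω) y)
    {g : E → ℕ → ℝ} (hg : ∀ y, Measurable fun x => g x y) (hg0 : ∀ x y, 0 ≤ g x y)
    {G : E → ℝ} (hG : Measurable G)
    (hc : ∀ᵐ ω ∂P, HasSum (fun y => g (X ω) y * f (X ω) y) (G (X ω))) :
    ∫ ω, g (X ω) (Y ω) ∂P = ∫ ω, G (X ω) ∂P := by
  have hgm : Measurable fun ω => g (X ω) (Y ω) :=
    (measurable_from_prod_countable_left (f := fun q : E × ℕ => g q.1 q.2) hg).comp (hX.prodMk hY)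
  have hG0 : 0 ≤ᵐ[P] fun ω => G (X ω) :=
    hc.mono fun ω hω => hω.nonneg fun y => mul_nonneg (hg0 _ _) (hf0 _ _)
  rw [integral_eq_lintegral_of_nonneg_ae (ae_of_all _ fun ω => hg0 _ _)
      hgm.aestronglyMeasurable, integral_eq_lintegral_of_nonneg_ae hG0
      (hG.comp hX).aestronglyMeasurable,
    lintegral_of_condLaw (g := fun x y => ENNReal.ofReal (g x y)) hX hY hf hf0 hlaw
      fun y => (hg y).ennreal_ofReal]
  congr 1
  refine lintegral_congr_ae (hc.mono fun ω hω => ?_)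
  simp only [← ENNReal.ofReal_mul (hg0 _ _)]
  rw [← ENNReal.ofReal_tsum_of_nonneg (fun y => mul_nonneg (hg0 _ _) (hf0 _ _)) hω.summable,
    hω.tsum_eq]

end CondLaw

/-! ### Tail bounds for independent sums. -/

/-- Bernstein-type tail bound for sums of independent variables with a quadratic bound on the
logarithm of the moment generating function near the origin. -/
theorem measureReal_sum_ge_le {Ω : Type*} [MeasurableSpace Ω] {P : Measure Ω}
    [IsProbabilityMeasure P] {n : ℕ} {ξ : Fin n → Ω → ℝ} (hind : iIndepFun ξ P)
    (hmeas : ∀ i, Measurable (ξ i)) {b s t : ℝ} (hs : 0 ≤ s)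
    (hmgf : ∀ i, Integrable (fun ω => Real.exp (s * ξ i ω)) P ∧ mgf (ξ i) P s ≤ Real.exp b) :
    P.real {ω | t ≤ ∑ i, ξ i ω} ≤ Real.exp (-s * t + n * b) := by
  have h1 := measure_ge_le_exp_mul_mgf (μ := P) (X := ∑ i, ξ i) t hs
    (hind.integrable_exp_mul_sum hmeas fun i _ => (hmgf i).1)
  simp only [Finset.sum_apply] at h1
  refine h1.trans ?_
  rw [hind.mgf_sum hmeas, Real.exp_add]
  gcongr
  calc ∏ i, mgf (ξ i) P s ≤ ∏ _i : Fin n, Real.exp b :=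
        Finset.prod_le_prod (fun i _ => mgf_nonneg) fun i _ => (hmgf i).2
    _ = Real.exp (n * b) := by simp [Real.exp_nat_mul]

/-- Chebyshev's inequality for sums of independent centred variables. -/
theorem measureReal_sum_ge_le_of_variance {Ω : Type*} [MeasurableSpace Ω] {P : Measure Ω}
    [IsProbabilityMeasure P] {n : ℕ} {T : Fin n → Ω → ℝ} (hind : iIndepFun T P)
    (hL2 : ∀ i, MemLp (T i) 2 P) (hmean : ∀ i, ∫ ω, T i ω ∂P = 0) {v c : ℝ}
    (hv : ∀ i, ∫ ω, T i ω ^ 2 ∂P ≤ v) (hc : 0 < c) :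
    P.real {ω | c ≤ ∑ i, T i ω} ≤ n * v / c ^ 2 := by
  have hS : MemLp (fun ω => ∑ i, T i ω) 2 P := memLp_finsetSum _ fun i _ => hL2 i
  have hm : ∫ ω, ∑ i, T i ω ∂P = 0 := by
    rw [integral_finsetSum _ fun i _ => (hL2 i).integrable (by norm_num)]
    simp [hmean]
  have h1 := meas_ge_le_variance_div_sq hS hc
  rw [hm] at h1
  have hvar : Var[fun ω => ∑ i, T i ω; P] ≤ n * v := by
    have h2 := IndepFun.variance_sum (X := T) (s := Finset.univ) (μ := P) (fun i _ => hL2 i)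
      (fun i _ j _ hij => hind.indepFun hij)
    have h3 : (∑ i, T i) = fun ω => ∑ i, T i ω := by ext; simp
    rw [h3] at h2
    rw [h2]
    calc ∑ i, Var[T i; P] ≤ ∑ _i : Fin n, v := Finset.sum_le_sum fun i _ => by
          rw [variance_of_integral_eq_zero (hL2 i).1.aemeasurable (hmean i)]
          exact hv i
      _ = n * v := by simp
  have h4 : P {ω | c ≤ ∑ i, T i ω} ≤ ENNReal.ofReal (n * v / c ^ 2) := by
    refine (measure_mono fun ω hω => ?_).trans (h1.trans (ENNReal.ofReal_le_ofReal (by gcongr)))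
    have hω' : c ≤ ∑ i, T i ω := hω
    simpa using hω'.trans (le_abs_self _)
  have hv0 : 0 ≤ n * v := (variance_nonneg _ _).trans hvar
  exact ENNReal.toReal_le_of_le_ofReal (by positivity) h4

/-- The choice `s = A √r / b` works when it respects `s b ≤ 1 / 2`; otherwise the boundary value `1
/ (2 b)` does. The square-root bound on `lam` serves the first case and the linear bound the second.
-/
theorem exists_chernoff_parameter {A b r lam : ℝ} (hA : 0 < A) (hb : 0 < b) (hr : 0 ≤ r)
    (h1 : 32 * A ^ 2 * b * r ≤ lam) (h2 : 16 * √2 * A * b * √r ≤ lam) :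
    ∃ s : ℝ, 0 ≤ s ∧ s * b ≤ 1 / 2 ∧ 4 * (s * b) ^ 2 - s * (lam / 2) ≤ -(A ^ 2 * r) := by
  have hsr : √r ^ 2 = r := Real.sq_sqrt hr
  rcases le_total (1 / 2) (A * √r) with h | h
  · refine ⟨1 / (2 * b), by positivity, by field_simp; norm_num, ?_⟩
    have h3 : 1 / 4 ≤ A ^ 2 * r := by
      rw [← hsr, ← mul_pow]
      nlinarith
    have h4 : 1 / (2 * b) * (32 * A ^ 2 * b * r / 2) ≤ 1 / (2 * b) * (lam / 2) := by gcongr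
    have h5 : 1 / (2 * b) * (32 * A ^ 2 * b * r / 2) = 8 * (A ^ 2 * r) := by field_simp; ring
    have h6 : 1 / (2 * b) * b = 1 / 2 := by field_simp
    rw [h6]
    linarith
  · refine ⟨A * √r / b, by positivity, by field_simp; linarith, ?_⟩
    have h3 : A * √r / b * (16 * √2 * A * b * √r / 2) ≤ A * √r / b * (lam / 2) := by gcongr
    have h4 : A * √r / b * (16 * √2 * A * b * √r / 2) = 8 * √2 * (A ^ 2 * r) := by
      rw [← hsr]; field_simp; rw [Real.sqrt_sq (Real.sqrt_nonneg r)]; ring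
    have h5 : A * √r / b * b = A * √r := by field_simp
    have h6 : 1 ≤ √2 := Real.one_le_sqrt.mpr (by norm_num)
    have h7 : 0 ≤ A ^ 2 * r := by positivity
    rw [h5, mul_pow, hsr]
    nlinarith

/-! ### The exceptional event of the regression model. -/

namespace OracleHypotheses

variable {Ω : Type u} [MeasurableSpace Ω] {P : Measure Ω} {n p : ℕ}
    {X : Fin n → Ω → Fin p → ℝ} {Y : Fin n → Ω → ℕ} {βs : Fin p → ℝ}
    {θ L B k A C ε lam1 lam2 : ℝ}

theorem measurable_nbPMF (θ : ℝ) (βs : Fin p → ℝ) (y : ℕ) :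
    Measurable fun x : Fin p → ℝ => nbPMF θ (Real.exp (x ⬝ᵥ βs)) y := by
  unfold nbPMF dotProduct
  fun_prop

theorem momentConstant_pos (hθ : 0 < θ) (hLB : 0 ≤ L * B) (h : IsMomentConstant θ (L * B) C) :
    0 < C := by
  have h1 := h 0 (by simpa using hLB)
  obtain ⟨M₂, M₃, M₄, h2, -⟩ := nb_moments hθ (Real.exp_pos 0) fun q hq => (h1 q hq).1
  have h3 := (h1 1 le_rfl).2
  simp only [pow_one] at h3
  rw [h2.tsum_eq] at h3
  simp at h3
  linarith

theorem lam1_pos (H : OracleHypotheses P X Y βs θ L B k A C ε lam1 lam2) (hθ : 0 < θ) (hL : 0 < L)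
    (hB : 0 < B) : 0 < lam1 := by
  refine lt_of_lt_of_le ?_ H.lam1_ge
  refine lt_of_lt_of_le ?_ (le_max_left _ _)
  have hC := momentConstant_pos hθ (by positivity) H.momentConstant
  have hA : 0 < A := one_pos.trans H.one_lt_A
  have hn : (0 : ℝ) < n := by exact_mod_cast H.n_pos
  have hp : (1 : ℝ) ≤ p := by exact_mod_cast H.p_pos
  have hlog : 0 < Real.log (2 * (p : ℝ)) := Real.log_pos (by linarith)
  positivity

/-- Given the row, each summand is the centred response times a coefficient of size at most `L`, so
`nb_mgf_le` applies conditionally. The Chernoff exponent is then at most `-A² log (2p)`. -/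
theorem gradient_tail (H : OracleHypotheses P X Y βs θ L B k A C ε lam1 lam2) (hθ : 0 < θ)
    (hL : 0 < L) (hB : 0 < B) (j : Fin p) {σ : ℝ} (hσ : |σ| = 1) :
    P.real {ω | n * (lam1 / 2) ≤ ∑ i, σ * (nbScore θ (Y i ω) (X i ω ⬝ᵥ βs) * X i ω j)}
      ≤ (2 * (p : ℝ)) ^ (-A ^ 2) := by
  have := H.isProb
  have hC := momentConstant_pos hθ (by positivity) H.momentConstant
  have hA : 0 < A := one_pos.trans H.one_lt_A
  have hn : (0 : ℝ) < n := by exact_mod_cast H.n_pos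
  have hp : (1 : ℝ) ≤ p := by exact_mod_cast H.p_pos
  have hlog : 0 < Real.log (2 * (p : ℝ)) := Real.log_pos (by linarith)
  have ht := H.lam1_ge
  rw [tuningBound, max_le_iff, max_le_iff] at ht
  obtain ⟨s, hs0, hsb, hs⟩ := exists_chernoff_parameter (A := A) (b := L * C)
    (r := Real.log (2 * (p : ℝ)) / n) (lam := lam1) hA (by positivity) (by positivity)
    (by linarith [ht.1]) (by linarith [ht.2.1])
  let F : (Fin p → ℝ) × ℕ → ℝ := fun q => σ * (nbScore θ q.2 (q.1 ⬝ᵥ βs) * q.1 j)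
  have hFm : Measurable F := by
    simp only [F, nbScore, dotProduct]
    fun_prop
  have hmeas : ∀ i, Measurable fun ω => F (X i ω, Y i ω) := fun i =>
    hFm.comp ((H.measurable_X i).prodMk (H.measurable_Y i))
  have hind : iIndepFun (fun i ω => F (X i ω, Y i ω)) P := H.indep.comp (fun _ => F) fun _ => hFm
  have hmgf : ∀ i, Integrable (fun ω => Real.exp (s * F (X i ω, Y i ω))) P ∧
      mgf (fun ω => F (X i ω, Y i ω)) P s ≤ Real.exp (4 * (s * (L * C)) ^ 2) := by
    intro i
    refine integral_le_of_condLaw (f := fun x y => nbPMF θ (Real.exp (x ⬝ᵥ βs)) y)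
      (g := fun x y => Real.exp (s * F (x, y))) (H.measurable_X i)
      (H.measurable_Y i) (measurable_nbPMF θ βs) (fun x y => (nbPMF_pos hθ (Real.exp_pos _) y).le)
      (H.condLaw i) (fun y => ((hFm.comp measurable_prodMk_right).const_mul s).exp)
      (fun x y => (Real.exp_pos _).le) (Real.exp_pos _).le ?_
    filter_upwards [H.bounded_X i, H.bounded_predictor i] with ω hX hη
    set η := X i ω ⬝ᵥ βs with hηdef
    set a := s * (σ * (θ / (θ + Real.exp η) * X i ω j)) with ha
    have ha' : |a| ≤ s * L := by
      rw [ha, abs_mul, abs_mul, hσ, abs_mul, abs_of_nonneg hs0, one_mul]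
      have h1 : |θ / (θ + Real.exp η)| ≤ 1 := by
        rw [abs_of_pos (by positivity), div_le_one (by positivity)]
        linarith [Real.exp_pos η]
      have h2 : |θ / (θ + Real.exp η)| * |X i ω j| ≤ 1 * L :=
        mul_le_mul h1 (hX j) (abs_nonneg _) zero_le_one
      exact mul_le_mul_of_nonneg_left (by linarith) hs0
    have haC : |a| * C ≤ s * (L * C) := by nlinarith
    have h1 := nb_mgf_le hθ (Real.exp_pos η) (C := C) (a := a) hC (H.momentConstant η hη)
      (haC.trans hsb)
    have h2 : ∀ y : ℕ, s * F (X i ω, y) = a * ((y : ℝ) - Real.exp η) := by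
      intro y
      simp only [F, nbScore, ha, ← hηdef]
      ring
    simp only [h2]
    refine ⟨h1.1, h1.2.trans (Real.exp_le_exp.mpr ?_)⟩
    have h3 : (a * C) ^ 2 ≤ (s * (L * C)) ^ 2 := by
      rw [← sq_abs (a * C), abs_mul, abs_of_pos hC]
      exact pow_le_pow_left₀ (by positivity) haC 2
    linarith
  refine (measureReal_sum_ge_le hind hmeas hs0 hmgf).trans ?_
  rw [Real.rpow_def_of_pos (by linarith)]
  refine Real.exp_le_exp.mpr ?_
  have h1 := mul_le_mul_of_nonneg_left hs hn.le
  have h2 : (n : ℝ) * -(A ^ 2 * (Real.log (2 * (p : ℝ)) / n))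
      = Real.log (2 * (p : ℝ)) * -A ^ 2 := by field_simp
  rw [h2] at h1
  linarith

/-- Subtracting the conditional variance centres the squared residuals, and `sqVarBound` bounds the
second moment of the result; Chebyshev's inequality concludes. -/
theorem residual_tail (H : OracleHypotheses P X Y βs θ L B k A C ε lam1 lam2) (hθ : 0 < θ)
    {E : ℝ} (hE : 0 < E) :
    P.real {ω | n * E ≤ ∑ i, (((Y i ω : ℝ) - Real.exp (X i ω ⬝ᵥ βs)) ^ 2
        - Real.exp (X i ω ⬝ᵥ βs) * (θ + Real.exp (X i ω ⬝ᵥ βs)) / θ)}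
      ≤ sqVarBound θ L B / (n * E ^ 2) := by
  have := H.isProb
  have hn : (0 : ℝ) < n := by exact_mod_cast H.n_pos
  let V : (Fin p → ℝ) → ℝ := fun x => Real.exp (x ⬝ᵥ βs) * (θ + Real.exp (x ⬝ᵥ βs)) / θ
  let W : (Fin p → ℝ) × ℕ → ℝ := fun q => ((q.2 : ℝ) - Real.exp (q.1 ⬝ᵥ βs)) ^ 2
  let F : (Fin p → ℝ) × ℕ → ℝ := fun q => W q - V q.1
  have hVm : Measurable V := by
    simp only [V, dotProduct]
    fun_prop
  have hWm : Measurable W := by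
    simp only [W, dotProduct]
    fun_prop
  have hFm : Measurable F := hWm.sub (hVm.comp measurable_fst)
  have hpair : ∀ i, Measurable fun ω => (X i ω, Y i ω) := fun i =>
    (H.measurable_X i).prodMk (H.measurable_Y i)
  have hind : iIndepFun (fun i ω => F (X i ω, Y i ω)) P := H.indep.comp (fun _ => F) fun _ => hFm
  have hμ : 0 < varBound θ L B := varBound_pos hθ
  have hV0 : ∀ x, 0 < V x := fun x => by simp only [V]; positivity
  have hVle : ∀ i, ∀ᵐ ω ∂P, V (X i ω) ≤ varBound θ L B := by
    intro i
    filter_upwards [H.bounded_predictor i] with ω hη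
    have := Real.exp_le_exp.mpr (abs_le.mp hη).2
    simp only [V, varBound]
    gcongr
  have hσ0 : 0 ≤ sqVarBound θ L B := by unfold sqVarBound; positivity
  have hf0 : ∀ (x : Fin p → ℝ) (y : ℕ), 0 ≤ nbPMF θ (Real.exp (x ⬝ᵥ βs)) y := fun x y =>
    (nbPMF_pos hθ (Real.exp_pos _) y).le
  have hsq : ∀ i, Integrable (fun ω => F (X i ω, Y i ω) ^ 2) P ∧
      ∫ ω, F (X i ω, Y i ω) ^ 2 ∂P ≤ sqVarBound θ L B := by
    intro i
    refine integral_le_of_condLaw (f := fun x y => nbPMF θ (Real.exp (x ⬝ᵥ βs)) y)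
      (g := fun x y => F (x, y) ^ 2) (H.measurable_X i) (H.measurable_Y i)
      (measurable_nbPMF θ βs) hf0 (H.condLaw i)
      (fun y => (hFm.comp measurable_prodMk_right).pow_const 2) (fun x y => sq_nonneg _) hσ0 ?_
    filter_upwards [H.bounded_predictor i, hVle i] with ω hη hV
    have h1 := hasSum_nb_sq_variance hθ (Real.exp_pos (X i ω ⬝ᵥ βs))
      fun q hq => (H.momentConstant _ hη q hq).1
    refine ⟨h1.summable, h1.tsum_eq.le.trans ?_⟩
    have h2 := hV0 (X i ω)
    change (2 + 6 / θ) * V (X i ω) ^ 2 + V (X i ω) ≤ sqVarBound θ L B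
    unfold sqVarBound
    gcongr
  have hvar : ∀ i, ∀ᵐ ω ∂P, HasSum (fun y : ℕ => W (X i ω, y)
      * nbPMF θ (Real.exp (X i ω ⬝ᵥ βs)) y) (V (X i ω)) := by
    intro i
    filter_upwards [H.bounded_predictor i] with ω hη
    have h := hasSum_nb_variance hθ (Real.exp_pos (X i ω ⬝ᵥ βs))
      fun q hq => (H.momentConstant _ hη q hq).1
    simpa only [W, V] using h
  have hWint : ∀ i, Integrable (fun ω => W (X i ω, Y i ω)) P := by
    intro i
    refine (integral_le_of_condLaw (f := fun x y => nbPMF θ (Real.exp (x ⬝ᵥ βs)) y)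
      (g := fun x y => W (x, y)) (H.measurable_X i) (H.measurable_Y i)
      (measurable_nbPMF θ βs) hf0 (H.condLaw i)
      (fun y => hWm.comp measurable_prodMk_right) (fun x y => sq_nonneg _) hμ.le ?_).1
    filter_upwards [hvar i, hVle i] with ω h1 h2
    exact ⟨h1.summable, h1.tsum_eq.le.trans h2⟩
  have hL2 : ∀ i, MemLp (fun ω => F (X i ω, Y i ω)) 2 P := fun i =>
    (memLp_two_iff_integrable_sq (hFm.comp (hpair i)).aestronglyMeasurable).mpr (hsq i).1
  have hmean : ∀ i, ∫ ω, F (X i ω, Y i ω) ∂P = 0 := by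
    intro i
    have h1 : ∫ ω, W (X i ω, Y i ω) ∂P = ∫ ω, V (X i ω) ∂P :=
      integral_eq_of_condLaw (f := fun x y => nbPMF θ (Real.exp (x ⬝ᵥ βs)) y)
        (g := fun x y => W (x, y)) (H.measurable_X i) (H.measurable_Y i)
        (measurable_nbPMF θ βs) hf0 (H.condLaw i)
        (fun y => hWm.comp measurable_prodMk_right) (fun x y => sq_nonneg _) hVm (hvar i)
    have h2 : Integrable (fun ω => V (X i ω)) P := by
      refine ((hWint i).sub ((hL2 i).integrable (by norm_num))).congr (ae_of_all _ fun ω => ?_)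
      simp only [F, Pi.sub_apply]
      ring
    simp only [F]
    rw [integral_sub (hWint i) h2, h1, sub_self]
  have h := measureReal_sum_ge_le_of_variance hind hL2 hmean (fun i => (hsq i).2)
    (by positivity : 0 < n * E)
  refine h.trans (le_of_eq ?_)
  field_simp

/-- Outside a set of probability at most `failureProb`, the covariates are bounded, the gradient at
the true coefficients is dominated by the penalty and the mean squared residual is controlled. -/
theorem exists_bad_set (H : OracleHypotheses P X Y βs θ L B k A C ε lam1 lam2) (hθ : 0 < θ)
    (hL : 0 < L) (hB : 0 < B) {E : ℝ} (hE : 0 < E) :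
    ∃ bad : Set Ω, P.real bad ≤ failureProb θ L B A E n p ∧ ∀ ω ∉ bad,
      (∀ i j, |X i ω j| ≤ L) ∧
      (∀ j, |(1 / (n : ℝ)) * ∑ i, nbScore θ (Y i ω) (X i ω ⬝ᵥ βs) * X i ω j| ≤ lam1 / 2) ∧
      (1 / (n : ℝ)) * ∑ i, ((Y i ω : ℝ) - Real.exp (X i ω ⬝ᵥ βs)) ^ 2 ≤ E + varBound θ L B := by
  have := H.isProb
  have hn : (0 : ℝ) < n := by exact_mod_cast H.n_pos
  have hp : (0 : ℝ) < p := by exact_mod_cast H.p_pos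
  let S : ℝ → Fin p → Set Ω := fun σ j =>
    {ω | n * (lam1 / 2) ≤ ∑ i, σ * (nbScore θ (Y i ω) (X i ω ⬝ᵥ βs) * X i ω j)}
  let T : Set Ω := {ω | n * E ≤ ∑ i, (((Y i ω : ℝ) - Real.exp (X i ω ⬝ᵥ βs)) ^ 2
        - Real.exp (X i ω ⬝ᵥ βs) * (θ + Real.exp (X i ω ⬝ᵥ βs)) / θ)}
  let N : Set Ω := {ω | ¬ ∀ i, (∀ j, |X i ω j| ≤ L) ∧ |X i ω ⬝ᵥ βs| ≤ L * B}
  have hN : P.real N = 0 := by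
    have h1 : ∀ᵐ ω ∂P, ∀ i, (∀ j, |X i ω j| ≤ L) ∧ |X i ω ⬝ᵥ βs| ≤ L * B :=
      ae_all_iff.mpr fun i => (H.bounded_X i).and (H.bounded_predictor i)
    rw [measureReal_def, show P N = 0 from h1, ENNReal.toReal_zero]
  refine ⟨((⋃ j, (S 1 j ∪ S (-1) j)) ∪ T) ∪ N, ?_, ?_⟩
  -- There are `2p` one-sided events, two signs for each coordinate, each of probability at most
  -- `(2p)^(-A²)`. Together they use only one of the two copies of `(2p)^(1 - A²)` in `failureProb`.
  · have h1 : P.real (⋃ j, (S 1 j ∪ S (-1) j)) ≤ (2 * (p : ℝ)) ^ (1 - A ^ 2) := by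
      refine (measureReal_iUnion_fintype_le _).trans ?_
      calc ∑ j, P.real (S 1 j ∪ S (-1) j)
          ≤ ∑ _j : Fin p, ((2 * (p : ℝ)) ^ (-A ^ 2) + (2 * (p : ℝ)) ^ (-A ^ 2)) :=
            Finset.sum_le_sum fun j _ => (measureReal_union_le _ _).trans
              (add_le_add (H.gradient_tail hθ hL hB j (by simp))
                (H.gradient_tail hθ hL hB j (by simp)))
        _ = (2 * (p : ℝ)) ^ (1 - A ^ 2) := by
          rw [sub_eq_add_neg, Real.rpow_add (by positivity), Real.rpow_one]
          simp
          ring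
    have h2 : P.real T ≤ sqVarBound θ L B / (n * E ^ 2) := H.residual_tail hθ hE
    have h3 := measureReal_union_le (μ := P) ((⋃ j, (S 1 j ∪ S (-1) j)) ∪ T) N
    have h4 := measureReal_union_le (μ := P) (⋃ j, (S 1 j ∪ S (-1) j)) T
    have h5 : 0 < (2 * (p : ℝ)) ^ (1 - A ^ 2) := by positivity
    have h6 : 0 < (2 * (p : ℝ)) ^ (-A ^ 2) := by positivity
    unfold failureProb
    linarith
  · intro ω hω
    simp only [Set.mem_union, Set.mem_iUnion, not_or, not_exists] at hω
    obtain ⟨⟨hS, hT⟩, hNω⟩ := hω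
    have hbd : ∀ i, (∀ j, |X i ω j| ≤ L) ∧ |X i ω ⬝ᵥ βs| ≤ L * B := not_not.mp hNω
    refine ⟨fun i => (hbd i).1, fun j => ?_, ?_⟩
    · obtain ⟨h1, h2⟩ := hS j
      simp only [S, Set.mem_ofPred_eq, not_le] at h1 h2
      rw [← Finset.mul_sum] at h1 h2
      rw [abs_mul, abs_of_pos (by positivity), one_div, inv_mul_le_iff₀ hn, abs_le]
      constructor <;> linarith
    · have h1 := hT
      simp only [T, Set.mem_ofPred_eq, not_le] at h1
      rw [Finset.sum_sub_distrib] at h1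
      have h2 : ∑ i, Real.exp (X i ω ⬝ᵥ βs) * (θ + Real.exp (X i ω ⬝ᵥ βs)) / θ
          ≤ n * varBound θ L B := by
        calc _ ≤ ∑ _i : Fin n, varBound θ L B := Finset.sum_le_sum fun i _ => by
              have := Real.exp_le_exp.mpr (abs_le.mp (hbd i).2).2
              unfold varBound
              gcongr
          _ = n * varBound θ L B := by simp
      rw [one_div, inv_mul_le_iff₀ hn]
      linarith

/-- Outside a set of probability at most `failureProb`, the grouping inequality holds. -/
theorem grouping (H : OracleHypotheses P X Y βs θ L B k A C ε lam1 lam2) (hθ : 0 < θ)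
    (hL : 0 < L) (hB : 0 < B) {D : ℕ} (hD : (coefSupport βs).card ≤ D) {βhat : Ω → Fin p → ℝ}
    (hβ : ∀ ω, IsElasticNet θ lam1 lam2 (fun i => X i ω) (fun i => Y i ω) (βhat ω))
    {E : ℝ} (hE : 0 < E) :
    ∃ bad : Set Ω, P.real bad ≤ failureProb θ L B A E n p ∧ ∀ ω ∉ bad,
      Standardized (fun i => X i ω) → ∀ k l : Fin p, (βhat ω k - βhat ω l) ^ 2
        ≤ 1 / 2 * ((1 - empCorr (fun i => X i ω) k l) / lam2 ^ 2)
          * (lam2 ^ 2 * groupConst θ L B D + (E + varBound θ L B)) := by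
  obtain ⟨bad, h1, h2⟩ := H.exists_bad_set hθ hL hB hE
  refine ⟨bad, h1, fun ω hω hstd k l => ?_⟩
  obtain ⟨h3, h4, h5⟩ := h2 ω hω
  exact (hβ ω).grouping_oracle hθ hL hB hE (H.lam1_pos hθ hL hB) H.lam2_eq h3 H.bounded_beta hD
    h4 h5 hstd k l

end OracleHypotheses

/-! ### Assembly of the two statements. -/

/-- Subadditivity is applied to the cover `bad ∪ S` instead of passing to complements, so no
measurability of `S`, and hence of the estimator, is required. -/
theorem one_sub_le_measureReal_of_compl_subset {Ω : Type*} [MeasurableSpace Ω] {P : Measure Ω}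
    [IsProbabilityMeasure P] {bad S : Set Ω} {q : ℝ} (hbad : P.real bad ≤ q)
    (h : ∀ ω ∉ bad, ω ∈ S) : 1 - q ≤ P.real S := by
  have h1 : (Set.univ : Set Ω) ⊆ bad ∪ S := fun ω _ => or_iff_not_imp_left.mpr (h ω)
  have h2 := measureReal_mono (μ := P) h1
  have h3 := measureReal_union_le (μ := P) bad S
  simp only [probReal_univ] at h2
  linarith

theorem tendsto_failureProb (θ L B : ℝ) {A : ℝ} (hA : 1 < A) {n p : ℕ → ℕ}
    (hn : Tendsto n atTop atTop) (hp : Tendsto p atTop atTop) :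
    Tendsto (fun r => failureProb θ L B A 1 (n r) (p r)) atTop (𝓝 0) := by
  have hp' : Tendsto (fun r => 2 * (p r : ℝ)) atTop atTop :=
    (tendsto_natCast_atTop_atTop.comp hp).const_mul_atTop (by norm_num)
  have hn' : Tendsto (fun r => (n r : ℝ) * 1 ^ 2) atTop atTop := by
    simpa [Function.comp_def] using (tendsto_natCast_atTop_atTop (R := ℝ)).comp hn
  have h1 : Tendsto (fun r => (2 * (p r : ℝ)) ^ (1 - A ^ 2)) atTop (𝓝 0) := by
    have := (tendsto_rpow_neg_atTop (y := A ^ 2 - 1) (by nlinarith)).comp hp'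
    simpa [Function.comp_def] using this
  have h2 : Tendsto (fun r => (2 * (p r : ℝ)) ^ (-A ^ 2)) atTop (𝓝 0) :=
    (tendsto_rpow_neg_atTop (y := A ^ 2) (by positivity)).comp hp'
  have h3 : Tendsto (fun r => sqVarBound θ L B / ((n r : ℝ) * 1 ^ 2)) atTop (𝓝 0) :=
    tendsto_const_nhds.div_atTop hn'
  simpa [failureProb] using ((h1.const_mul 2).add h2).add h3

theorem mainTheorem6 (θ L B κ : ℝ) (D : ℕ) (hθ : 0 < θ) (hL : 0 < L) (hB : 0 < B) :
    ∃ O1 : ℝ, 0 ≤ O1 ∧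
      (∀ (Ω : Type u) (_ : MeasurableSpace Ω) (P : Measure Ω) (n p : ℕ)
          (X : Fin n → Ω → Fin p → ℝ) (Y : Fin n → Ω → ℕ) (βs : Fin p → ℝ)
          (βhat : Ω → Fin p → ℝ) (A C ε lam1 lam2 : ℝ),
        OracleHypotheses P X Y βs θ L B κ A C ε lam1 lam2 →
        (coefSupport βs).card ≤ D →
        (∀ ω, IsElasticNet θ lam1 lam2 (fun i => X i ω) (fun i => Y i ω) (βhat ω)) →
        ∀ E : ℝ, 0 < E →
          1 - failureProb θ L B A E n p ≤
            P.real {ω | Standardized (fun i => X i ω) → ∀ k l : Fin p,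
              |βhat ω k - βhat ω l| ^ 2 ≤
                1 / 2 * (1 - empCorr (fun i => X i ω) k l) *
                  (maxEntry (fun i => X i ω) * Real.exp (2 * L * radiusM B ε) * O1
                    + 1 / lam2 ^ 2 * (E + varBound θ L B))}) ∧
      (∀ (Ω : ℕ → Type u) (_ : ∀ r, MeasurableSpace (Ω r)) (P : ∀ r, Measure (Ω r))
          (n p : ℕ → ℕ) (X : ∀ r, Fin (n r) → Ω r → Fin (p r) → ℝ)
          (Y : ∀ r, Fin (n r) → Ω r → ℕ) (βs : ∀ r, Fin (p r) → ℝ)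
          (βhat : ∀ r, Ω r → Fin (p r) → ℝ) (A C : ℝ) (ε lam1 lam2 : ℕ → ℝ)
          (k l : ∀ r, Fin (p r)),
        (∀ r, OracleHypotheses (P r) (X r) (Y r) (βs r) θ L B κ A C (ε r) (lam1 r) (lam2 r)) →
        (∀ r, (coefSupport (βs r)).card ≤ D) →
        (∀ r ω, IsElasticNet θ (lam1 r) (lam2 r) (fun i => X r i ω) (fun i => Y r i ω)
          (βhat r ω)) →
        Tendsto n atTop atTop →
        Tendsto p atTop atTop →
        (fun r => lam2 r ^ 2) =O[atTop] (fun r => Real.log (p r : ℝ) / (n r : ℝ)) →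
        Tendsto (fun r => Real.log (p r : ℝ) / (n r : ℝ)) atTop (𝓝 0) →
        (∀ δ : ℝ, 0 < δ → Tendsto (fun r => (P r).real {ω | Standardized (fun i => X r i ω) ∧
          δ < |(1 - empCorr (fun i => X r i ω) (k r) (l r)) / lam2 r ^ 2|}) atTop (𝓝 0)) →
        (∀ E : ℝ, 0 < E → ∀ r,
          1 - failureProb θ L B A E (n r) (p r) ≤
            (P r).real {ω | Standardized (fun i => X r i ω) →
              |βhat r ω (k r) - βhat r ω (l r)| ≤
                √(1 / 2 * ((1 - empCorr (fun i => X r i ω) (k r) (l r)) / lam2 r ^ 2) *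
                  (lam2 r ^ 2 * Real.exp (2 * L * radiusM B (ε r)) * O1
                    + (E + varBound θ L B)))}) ∧
        (∀ δ : ℝ, 0 < δ → Tendsto (fun r => (P r).real {ω | Standardized (fun i => X r i ω) ∧
          δ < |βhat r ω (k r) - βhat r ω (l r)|}) atTop (𝓝 0))) := by
  refine ⟨groupConst θ L B D, groupConst_nonneg D hθ, ?_, ?_⟩
  · intro Ω _ P n p X Y βs βhat A C ε lam1 lam2 H hD hβ E hE
    have := H.isProb
    obtain ⟨bad, hbad, hgood⟩ := H.grouping hθ hL hB hD hβ hE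
    refine one_sub_le_measureReal_of_compl_subset hbad fun ω hω hstd k l => ?_
    have hρ := one_sub_empCorr_nonneg hstd k l
    have hG := groupConst_nonneg (L := L) (B := B) D hθ
    have hK := one_le_maxEntry_of_standardized H.n_pos hstd k
    have hM : 0 ≤ radiusM B ε := by
      have := H.eps_nonneg
      unfold radiusM
      positivity
    have hexp : 1 ≤ Real.exp (2 * L * radiusM B ε) := Real.one_le_exp (by positivity)
    have hlam2 : 0 < lam2 := by
      have := H.lam1_pos hθ hL hB
      rw [H.lam2_eq]
      positivity
    rw [sq_abs]
    refine (hgood ω hω hstd k l).trans ?_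
    -- The two factors `1` are placeholders, to be enlarged to `K ≥ 1` and `e^{2LM} ≥ 1`.
    have h1 : 1 / 2 * ((1 - empCorr (fun i => X i ω) k l) / lam2 ^ 2)
        * (lam2 ^ 2 * groupConst θ L B D + (E + varBound θ L B))
        = 1 / 2 * (1 - empCorr (fun i => X i ω) k l)
          * (1 * 1 * groupConst θ L B D + 1 / lam2 ^ 2 * (E + varBound θ L B)) := by
      field_simp
    rw [h1]
    gcongr
  · intro Ω _ P n p X Y βs βhat A C ε lam1 lam2 k l H hD hβ hn hp hlamO hlog hR
    have hG := groupConst_nonneg (L := L) (B := B) D hθ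
    have hμ := varBound_pos (L := L) (B := B) hθ
    refine ⟨fun E hE r => ?_, fun δ hδ => ?_⟩
    · have := (H r).isProb
      obtain ⟨bad, hbad, hgood⟩ := (H r).grouping hθ hL hB (hD r) (hβ r) hE
      refine one_sub_le_measureReal_of_compl_subset hbad fun ω hω hstd => ?_
      have hρ := one_sub_empCorr_nonneg hstd (k r) (l r)
      have hM : 0 ≤ radiusM B (ε r) := by
        have := (H r).eps_nonneg
        unfold radiusM
        positivity
      have hexp : 1 ≤ Real.exp (2 * L * radiusM B (ε r)) := Real.one_le_exp (by positivity)
      refine Real.abs_le_sqrt ((hgood ω hω hstd (k r) (l r)).trans ?_)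
      have h1 : lam2 r ^ 2 ≤ lam2 r ^ 2 * Real.exp (2 * L * radiusM B (ε r)) :=
        le_mul_of_one_le_right (sq_nonneg _) hexp
      gcongr
    · have hlam : Tendsto (fun r => lam2 r ^ 2) atTop (𝓝 0) := hlamO.trans_tendsto hlog
      -- For convergence `E = 1` is enough, and `c` bounds the bracket as soon as `λ₂² < 1`. The
      -- threshold `2 δ² / c` below is what `δ² < R c / 2` forces on `R`.
      set c := groupConst θ L B D + (1 + varBound θ L B) with hc
      have hc0 : 0 < c := by positivity
      have hA : 1 < A := (H 0).one_lt_A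
      have hlim := (hR (2 * δ ^ 2 / c) (by positivity)).add
        (tendsto_failureProb θ L B hA hn hp)
      rw [add_zero] at hlim
      refine tendsto_of_tendsto_of_tendsto_of_le_of_le' tendsto_const_nhds hlim
        (Eventually.of_forall fun r => measureReal_nonneg) ?_
      filter_upwards [hlam.eventually (gt_mem_nhds one_pos)] with r hr
      have := (H r).isProb
      obtain ⟨bad, hbad, hgood⟩ := (H r).grouping hθ hL hB (hD r) (hβ r) one_pos
      refine (measureReal_mono (fun ω hω => ?_)).trans
        ((measureReal_union_le _ bad).trans (add_le_add le_rfl hbad))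
      by_cases hb : ω ∈ bad
      · exact Or.inr hb
      · refine Or.inl ⟨hω.1, ?_⟩
        have h1 := hgood ω hb hω.1 (k r) (l r)
        have hρ := one_sub_empCorr_nonneg hω.1 (k r) (l r)
        set R := (1 - empCorr (fun i => X r i ω) (k r) (l r)) / lam2 r ^ 2
        have hR0 : 0 ≤ R := by positivity
        have h2 : lam2 r ^ 2 * groupConst θ L B D + (1 + varBound θ L B) ≤ c := by
          rw [hc]
          nlinarith
        have h3 : δ ^ 2 < |βhat r ω (k r) - βhat r ω (l r)| ^ 2 :=
          pow_lt_pow_left₀ hω.2 hδ.le (by norm_num)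
        rw [sq_abs] at h3
        have h4 : 1 / 2 * R * (lam2 r ^ 2 * groupConst θ L B D + (1 + varBound θ L B))
            ≤ 1 / 2 * R * c := by gcongr
        rw [abs_of_nonneg hR0, div_lt_iff₀ hc0]
        linarith
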